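/- Let $k\ge 0$ be an integer and $\ell\ge k$ a real number, and let $f_\ell(r)=(1-r^2)_+^\ell$ for $r\in\mathbb R$ (the indicator function of $(-1,1)$ if $\ell=0$). Let $\mathscr D$ be the operator $\mathscr D\varphi(r)=-\varphi'(r)/r$ for $r>0$, extended to $r=0$ by continuity, and let $\varphi_{\ell,k}=\mathscr D^k(f_\ell*f_\ell)$ on $[0,\infty)$ be the Wu function, where $*$ is the convolution on $\mathbb R$. Put $\Phi(x)=\varphi_{\ell,k}(\|x\|_2)$ for $x\in\mathbb R^{2k+1}$. For $s>0$ and $d=2k+1$, let $H^s(\mathbb R^{d})$ be the space of all real-valued $f\in L^2(\mathbb R^d)$ such that $(1+\|\cdot\|_2^2)^{s/2}\hat f\in L^2(\mathbb R^d)$, with the norm $$\|f\|_{H^s}^2=(2\pi)^{-d/2}\int_{\mathbb R^d}|\hat f(\omega)|^2(1+\|\omega\|_2^2)^s\,d\omega ,\qquad \hat f(\omega)=(2\pi)^{-d/2}\int_{\mathbb R^d} f(x)e^{-i\langle\omega,x\rangle}\,dx ,$$ where $\hat f$ is understood in the $L^2$ sense. Then $(x,y)\mapsto\Phi(x-y)$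 is a symmetric, strictly positive definite kernel on $\mathbb R^{2k+1}$ and has a native space, that is, a real Hilbert space $\mathcal N_\Phi(\mathbb R^{2k+1})$ of real-valued functions on $\mathbb R^{2k+1}$ whose reproducing kernel is $\Phi(x-y)$. For every real $s$ with $k+\tfrac12<s\le\ell+1$, the native space $\mathcal N_\Phi(\mathbb R^{2k+1})$ is contained in $H^s(\mathbb R^{2k+1})$ and is dense in it. -/

import Mathlib

open MeasureTheory Filter Topology
open scoped FourierTransform

noncomputable section

/-! ### Wu functions -/

/-- The truncated power `f_ℓ(r) = (1 - r ^ 2)_+ ^ ℓ`, which vanishes for `1 ≤ |r|` (also for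
`ℓ = 0`, where it is the indicator function of `(-1, 1)`). -/
def truncPow (ℓ : ℝ) (r : ℝ) : ℝ :=
  if |r| < 1 then (1 - r ^ 2) ^ ℓ else 0

/-- The operator `(𝒟 φ)(r) = -φ'(r) / r` for `r > 0`, extended by continuity to `r = 0`.
Only the values at `r ≥ 0` matter. -/
def dimWalk (φ : ℝ → ℝ) (r : ℝ) : ℝ :=
  if r = 0 then limUnder (𝓝[>] (0 : ℝ)) (fun t => -deriv φ t / t) else -deriv φ r / r

/-- The Wu function `φ_{ℓ,k} = 𝒟 ^ k (f_ℓ * f_ℓ)`, where `*` is the convolution on the real line. -/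
def wuFun (ℓ : ℝ) (k : ℕ) : ℝ → ℝ :=
  dimWalk^[k] (convolution (truncPow ℓ) (truncPow ℓ) (ContinuousLinearMap.mul ℝ ℝ) volume)

/-- The translation invariant kernel `(x, y) ↦ Φ(x - y)` on `ℝ ^ (2 k + 1)` of the radial function
`Φ(x) = φ_{ℓ,k}(‖x‖)`. -/
def wuKernel (ℓ : ℝ) (k : ℕ) (x y : EuclideanSpace ℝ (Fin (2 * k + 1))) : ℝ :=
  wuFun ℓ k ‖x - y‖

/-! ### Native spaces -/

/-- Symmetric (strictly) positive definite real kernels. -/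
structure IsPosDefKernel {X : Type*} (K : X → X → ℝ) : Prop where
  symm : ∀ x y, K x y = K y x
  pos : ∀ (S : Finset X) (c : X → ℝ), (∃ x ∈ S, c x ≠ 0) →
    0 < ∑ x ∈ S, ∑ y ∈ S, c x * c y * K x y

/-- The real Hilbert space `H` of real-valued functions on `X` is the native space of the symmetric
positive definite kernel `K`: its reproducing kernel is `K`. (Mathlib's `RKHS.kernel H x y` is a
linear map `ℝ → ℝ`, namely multiplication by the value of the reproducing kernel at `(x, y)`.) -/
structure IsNativeSpace {X : Type*} (K : X → X → ℝ) (H : Type*) [NormedAddCommGroup H]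
    [InnerProductSpace ℝ H] [CompleteSpace H] [RKHS ℝ H X ℝ] : Prop where
  posDef : IsPosDefKernel K
  kernel_eq : ∀ x y, RKHS.kernel H x y 1 = K x y

/-! ### Sobolev spaces of real-valued functions -/

/-- The `L²` Fourier transform of a real-valued function, in the normalization
`ξ ↦ ∫ f x * exp (-2 π i ⟪x, ξ⟫) dx`. -/
def fourierReal {d : ℕ} (f : Lp ℝ 2 (volume : Measure (EuclideanSpace ℝ (Fin d)))) :
    Lp ℂ 2 (volume : Measure (EuclideanSpace ℝ (Fin d))) :=
  𝓕 (Complex.ofRealCLM.compLp f)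

/-- `f ∈ H^s(ℝ^d)`: the real-valued function `f` is in `L²`, and so is
`ω ↦ (1 + ‖ω‖ ^ 2) ^ (s / 2) * f^(ω)`, where
`f^(ω) = (2 π) ^ (-d / 2) ∫ f x * exp (-i ⟪x, ω⟫) dx`. In terms of the variable `ξ = ω / (2 π)`
one has `f^(2 π ξ) = (2 π) ^ (-d / 2) * fourierReal f ξ`. -/
def MemSobolevReal {d : ℕ} (s : ℝ)
    (f : Lp ℝ 2 (volume : Measure (EuclideanSpace ℝ (Fin d)))) : Prop :=
  MemLp (fun ξ : EuclideanSpace ℝ (Fin d) =>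
    (((1 + ‖(2 * Real.pi) • ξ‖ ^ 2) ^ (s / 2) : ℝ) : ℂ) * fourierReal f ξ) 2 volume

/-- The Sobolev norm, `‖f‖ ^ 2 = (2 π) ^ (-d / 2) ∫ |f^(ω)| ^ 2 * (1 + ‖ω‖ ^ 2) ^ s dω`, after the
substitution `ω = 2 π ξ` (here `|f^(2 π ξ)| ^ 2 = (2 π) ^ (-d) * |fourierReal f ξ| ^ 2` and
`dω = (2 π) ^ d dξ`). -/
def sobolevNorm {d : ℕ} (s : ℝ)
    (f : Lp ℝ 2 (volume : Measure (EuclideanSpace ℝ (Fin d)))) : ℝ :=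
  Real.sqrt ((2 * Real.pi) ^ (-(d : ℝ) / 2) *
    ∫ ξ : EuclideanSpace ℝ (Fin d),
      ‖fourierReal f ξ‖ ^ 2 * (1 + ‖(2 * Real.pi) • ξ‖ ^ 2) ^ s)

/-- The set `N` of real-valued functions on `ℝ^d` is a dense subset of `H^s(ℝ^d)`: every member of
`N` is in `H^s(ℝ^d)`, and every element of `H^s(ℝ^d)` is a limit in the Sobolev norm of members
of `N`. -/
def IsDenseInSobolev {d : ℕ} (s : ℝ) (N : Set (EuclideanSpace ℝ (Fin d) → ℝ)) : Prop :=
  (∀ f ∈ N, ∃ F : Lp ℝ 2 (volume : Measure (EuclideanSpace ℝ (Fin d))),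
    F =ᵐ[volume] f ∧ MemSobolevReal s F) ∧
  ∀ G : Lp ℝ 2 (volume : Measure (EuclideanSpace ℝ (Fin d))), MemSobolevReal s G →
    ∀ ε : ℝ, 0 < ε → ∃ f ∈ N, ∃ F : Lp ℝ 2 (volume : Measure (EuclideanSpace ℝ (Fin d))),
      F =ᵐ[volume] f ∧ MemSobolevReal s F ∧ sobolevNorm s (G - F) < ε

end

/-! Everything rests on the Fourier transform of `Φ`, a positive multiple `m` of `ω ↦ f̂_ℓ(‖ω‖)²`.
On the line `f_ℓ * f_ℓ` has transform `f̂_ℓ²`. Up to a positive constant, each application of `𝒟`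
turns the radial Fourier integral of a profile in dimension `2j + 1` into that of the same profile
in dimension `2j + 3`, so `k` applications reach dimension `2k + 1` (`hasDerivAt_walkKernel`,
`exists_wuFun_eq`).

Two facts about `m` are needed. It is nonzero almost everywhere, because `f̂_ℓ` extends to an entire
function with `f̂_ℓ(0) > 0` (`countable_truncPowHat_eq_zero`). It is at most `C (1 +
‖2πω‖²)^(-(ℓ+1))`, by shifting the contour of the integral defining `f̂_ℓ`
(`exists_truncPowHat_sq_le`).

Strict positive definiteness follows from the first fact. Every member of the native space is the
inverse transform of `√m u` with `u ∈ L²` (`exists_eq_inner_feature`), and the decay of `√m` absorbs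
the Sobolev weight of any order `s ≤ ℓ + 1`; this gives containment. For density, let `W` be the
square root of the Sobolev weight. If `v ∈ L²` is orthogonal to the weighted transforms of all
translates of `Φ`, then `W m v` has vanishing inverse transform, hence `v = 0`
(`dense_span_weightedFeature`). This yields complex coefficients; their real parts do at least as
well, since the target is real-valued. -/

/-! ### Fourier transforms on `L¹ ∩ L²` and conjugation on `L²`. -/

section FourierPlancherel

variable {V : Type*} [NormedAddCommGroup V] [InnerProductSpace ℝ V] [FiniteDimensional ℝ V]
  [MeasurableSpace V] [BorelSpace V]

/-- Fubini's identity for the forward transform, applied to `φ` and `w(-·)`; the reflection turns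
forward transforms into inverse ones. -/
theorem integral_schwartz_fourierInv_mul (φ : SchwartzMap V ℂ) {w : V → ℂ} (hw : Integrable w) :
    ∫ x, (𝓕⁻ φ : SchwartzMap V ℂ) x * w x = ∫ x, φ x * 𝓕⁻ w x := by
  have h := VectorFourier.integral_fourierIntegral_smul_eq_flip (μ := volume) (ν := volume)
    (L := innerₗ V) Real.continuous_fourierChar continuous_inner φ.integrable
    (hw.comp_neg)
  have e1 : ∀ ξ, VectorFourier.fourierIntegral Real.fourierChar volume (innerₗ V) φ ξ
      = (𝓕⁻ φ : SchwartzMap V ℂ) (-ξ) := by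
    intro ξ
    rw [SchwartzMap.fourierInv_coe, Real.fourierInv_eq_fourier_neg, neg_neg]
    rfl
  have e2 : ∀ x, VectorFourier.fourierIntegral Real.fourierChar volume (innerₗ V).flip
      (fun y => w (-y)) x = 𝓕⁻ w x := by
    intro x
    rw [Real.fourierInv_eq_fourier_comp_neg]
    simp [Real.fourier_eq, VectorFourier.fourierIntegral, real_inner_comm]
  simp only [e1, e2, smul_eq_mul] at h
  rw [← h, ← integral_neg_eq_self]

theorem ae_eq_of_forall_integral_schwartz_mul {f g : V → ℂ} (hf : LocallyIntegrable f)
    (hg : LocallyIntegrable g) (h : ∀ φ : SchwartzMap V ℂ, ∫ x, φ x * f x = ∫ x, φ x * g x) :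
    f =ᵐ[volume] g := by
  refine ae_eq_of_integral_contDiff_smul_eq hf hg fun φ hφ hs => ?_
  have hs' : HasCompactSupport (fun x => (φ x : ℂ)) :=
    hs.comp_left (g := fun r : ℝ => (r : ℂ)) Complex.ofReal_zero
  have hφ' : ContDiff ℝ (⊤ : ℕ∞) (fun x => (φ x : ℂ)) := Complex.ofRealCLM.contDiff.comp hφ
  simpa using h (hs'.toSchwartzMap hφ')

/-- By duality: every Schwartz function is the inverse transform of another one, so `w` integrates
to zero against all of them. -/
theorem ae_eq_zero_of_fourierInv_eq_zero {w : V → ℂ} (hw : Integrable w)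
    (h : ∀ x, 𝓕⁻ w x = 0) : w =ᵐ[volume] 0 := by
  refine ae_eq_of_forall_integral_schwartz_mul hw.locallyIntegrable
    (locallyIntegrable_zero) fun φ => ?_
  have := integral_schwartz_fourierInv_mul (𝓕 φ) hw
  simpa [h] using this

/-- The `L²` transform is compatible with the distributional one, so both sides have the same
pairings with Schwartz functions. -/
theorem fourierInv_toLp_ae_eq {w : V → ℂ} (h1 : Integrable w) (h2 : MemLp w 2) :
    (𝓕⁻ h2.toLp : Lp ℂ 2 (volume : Measure V)) =ᵐ[volume] 𝓕⁻ w := by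
  have hc : Continuous (𝓕⁻ w) := by
    rw [Real.fourierInv_eq_fourier_comp_neg]
    exact VectorFourier.fourierIntegral_continuous Real.continuous_fourierChar
      continuous_inner h1.comp_neg
  refine ae_eq_of_forall_integral_schwartz_mul
    ((Lp.memLp _).locallyIntegrable (by norm_num)) hc.locallyIntegrable fun φ => ?_
  have h := congrArg (fun T => T φ) (Lp.fourierInv_toTemperedDistribution_eq h2.toLp)
  simp only [TemperedDistribution.fourierInv_apply, Lp.toTemperedDistribution_apply,
    smul_eq_mul] at h
  rw [← h, ← integral_schwartz_fourierInv_mul φ h1]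
  refine integral_congr_ae ?_
  filter_upwards [h2.coeFn_toLp] with x hx
  rw [hx]

/-- Both sides are continuous in `f`, so Schwartz functions suffice; for them conjugation passes
under the Fourier integral. -/
theorem fourier_star_Lp (f : Lp ℂ 2 (volume : Measure V)) :
    𝓕 (star f) = star (Lp.compMeasurePreserving (fun x : V => -x)
      (Measure.measurePreserving_neg volume) (𝓕 f)) := by
  have hstar : Continuous (fun f : Lp ℂ 2 (volume : Measure V) => star f) := by
    have hiso : Isometry (fun f : Lp ℂ 2 (volume : Measure V) => star f) := by
      refine Isometry.of_dist_eq fun f g => ?_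
      rw [dist_eq_norm, dist_eq_norm, Lp.norm_def, Lp.norm_def]
      congr 1
      refine eLpNorm_congr_norm_ae ?_
      filter_upwards [Lp.coeFn_sub (star f) (star g), Lp.coeFn_sub f g, Lp.coeFn_star f,
        Lp.coeFn_star g] with x h₁ h₂ h₃ h₄
      simp only [h₁, h₂, Pi.sub_apply, h₃, h₄, Pi.star_apply, ← star_sub, norm_star]
    exact hiso.continuous
  refine DenseRange.induction_on
    (p := fun f : Lp ℂ 2 (volume : Measure V) => 𝓕 (star f) = star (Lp.compMeasurePreserving
      (fun x : V => -x) (Measure.measurePreserving_neg volume) (𝓕 f)))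
    (SchwartzMap.denseRange_toLpCLM (p := 2) ENNReal.ofNat_ne_top) f ?_ fun φ => ?_
  · refine isClosed_eq ?_ ?_
    · exact (Lp.fourierTransformₗᵢ V ℂ).continuous.comp hstar
    · exact hstar.comp ((Lp.isometry_compMeasurePreserving _).continuous.comp
        (Lp.fourierTransformₗᵢ V ℂ).continuous)
  · simp only [SchwartzMap.toLpCLM_apply]
    set ψ : SchwartzMap V ℂ :=
      SchwartzMap.postcompCLM (𝕜 := ℝ) Complex.conjCLE.toContinuousLinearMap φ with hψ
    have hψv : ∀ x, ψ x = star (φ x) := fun x => by simp [hψ]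
    have e : star (φ.toLp 2 volume) = ψ.toLp 2 volume := by
      refine Lp.ext ?_
      filter_upwards [Lp.coeFn_star (φ.toLp 2 volume), φ.coeFn_toLp 2 volume,
        ψ.coeFn_toLp 2 volume] with x h₁ h₂ h₃
      rw [h₁, h₃, Pi.star_apply, h₂, hψv]
    rw [e, SchwartzMap.toLp_fourier_eq, SchwartzMap.toLp_fourier_eq]
    refine Lp.ext ?_
    have hn := Lp.coeFn_compMeasurePreserving ((𝓕 φ : SchwartzMap V ℂ).toLp 2 volume)
      (Measure.measurePreserving_neg (volume : Measure V))
    have hn2 := (Measure.measurePreserving_neg (volume : Measure V)).quasiMeasurePreserving.ae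
      ((𝓕 φ : SchwartzMap V ℂ).coeFn_toLp 2 volume)
    filter_upwards [(𝓕 ψ : SchwartzMap V ℂ).coeFn_toLp 2 volume, Lp.coeFn_star
      (Lp.compMeasurePreserving (fun x : V => -x) (Measure.measurePreserving_neg volume)
        ((𝓕 φ : SchwartzMap V ℂ).toLp 2 volume)), hn, hn2] with x h₁ h₂ h₃ h₄
    rw [h₁, h₂, Pi.star_apply, h₃, Function.comp_apply, h₄, SchwartzMap.fourier_coe,
      SchwartzMap.fourier_coe, Real.fourier_eq', Real.fourier_eq', RCLike.star_def, ← integral_conj]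
    congr 1
    ext y
    simp only [hψv, smul_eq_mul, map_mul, ← Complex.exp_conj]
    simp [Complex.conj_ofNat]

end FourierPlancherel

/-! ### The `L²` Fourier transform of real-valued functions. -/

section RealFourier

variable {d : ℕ}

theorem coeFn_ofReal_compLp (f : Lp ℝ 2 (volume : Measure (EuclideanSpace ℝ (Fin d)))) :
    (Complex.ofRealCLM.compLp f : EuclideanSpace ℝ (Fin d) → ℂ) =ᵐ[volume] fun x => (f x : ℂ) :=
  Complex.ofRealCLM.coeFn_compLp f

theorem fourierReal_sub (f g : Lp ℝ 2 (volume : Measure (EuclideanSpace ℝ (Fin d)))) :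
    fourierReal (f - g) = fourierReal f - fourierReal g := by
  have : Complex.ofRealCLM.compLp (f - g)
      = Complex.ofRealCLM.compLp f - Complex.ofRealCLM.compLp g :=
    (ContinuousLinearMap.compLpL 2 volume Complex.ofRealCLM).map_sub f g
  rw [fourierReal, this]
  exact (Lp.fourierTransformₗᵢ (EuclideanSpace ℝ (Fin d)) ℂ).map_sub _ _

theorem exists_fourierReal_ae_eq {w : EuclideanSpace ℝ (Fin d) → ℂ} (h1 : Integrable w)
    (h2 : MemLp w 2) {f : EuclideanSpace ℝ (Fin d) → ℝ}
    (hf : ∀ x, (f x : ℂ) = 𝓕⁻ w x) :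
    ∃ F : Lp ℝ 2 (volume : Measure (EuclideanSpace ℝ (Fin d))),
      F =ᵐ[volume] f ∧ fourierReal F =ᵐ[volume] w := by
  have hfw : (fun x => (f x : ℂ)) =ᵐ[volume]
      (𝓕⁻ h2.toLp : Lp ℂ 2 (volume : Measure (EuclideanSpace ℝ (Fin d)))) := by
    filter_upwards [fourierInv_toLp_ae_eq h1 h2] with x hx
    rw [hx, hf]
  have hfC : MemLp (fun x => (f x : ℂ)) 2 volume := (Lp.memLp _).ae_eq hfw.symm
  have hfR : MemLp f 2 volume := by simpa using hfC.re
  refine ⟨hfR.toLp, hfR.coeFn_toLp, ?_⟩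
  have : Complex.ofRealCLM.compLp hfR.toLp =
      (𝓕⁻ h2.toLp : Lp ℂ 2 (volume : Measure (EuclideanSpace ℝ (Fin d)))) := by
    refine Lp.ext ?_
    filter_upwards [coeFn_ofReal_compLp hfR.toLp, hfR.coeFn_toLp, hfw] with x h₁ h₂ h₃
    rw [h₁, h₂, h₃]
  rw [fourierReal, this, FourierTransform.fourier_fourierInv_eq]
  exact h2.coeFn_toLp

theorem fourierReal_neg_ae_eq (F : Lp ℝ 2 (volume : Measure (EuclideanSpace ℝ (Fin d)))) :
    ∀ᵐ ω : EuclideanSpace ℝ (Fin d), fourierReal F (-ω) = star (fourierReal F ω) := by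
  have hs : star (Complex.ofRealCLM.compLp F) = Complex.ofRealCLM.compLp F := by
    refine Lp.ext ?_
    filter_upwards [Lp.coeFn_star (Complex.ofRealCLM.compLp F), coeFn_ofReal_compLp F]
      with x h₁ h₂
    rw [h₁, Pi.star_apply, h₂]
    simp
  have h := fourier_star_Lp (Complex.ofRealCLM.compLp F)
  rw [hs] at h
  change fourierReal F = star (Lp.compMeasurePreserving _ _ (fourierReal F)) at h
  have hn := Lp.coeFn_compMeasurePreserving (fourierReal F)
      (Measure.measurePreserving_neg (volume : Measure (EuclideanSpace ℝ (Fin d))))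
  filter_upwards [Lp.coeFn_star (Lp.compMeasurePreserving (fun x : EuclideanSpace ℝ (Fin d) => -x)
    (Measure.measurePreserving_neg volume) (fourierReal F)), hn] with ω h₁ h₂
  rw [← h, Pi.star_apply, h₂] at h₁
  rw [h₁, star_star]
  rfl

end RealFourier

/-! ### Feature maps and strict positive definiteness from a spectral density. -/

section SpectralDensity

variable {V : Type*} [NormedAddCommGroup V] [InnerProductSpace ℝ V]


/-- The character `ω ↦ exp (-2 π i ⟪x, ω⟫)`. -/
noncomputable def planeWave (x ω : V) : ℂ :=
  Complex.exp (((-(2 * Real.pi * inner ℝ x ω) : ℝ) : ℂ) * Complex.I)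

theorem norm_planeWave (x ω : V) : ‖planeWave x ω‖ = 1 :=
  Complex.norm_exp_ofReal_mul_I _

theorem continuous_planeWave (x : V) : Continuous (planeWave x) := by
  unfold planeWave
  fun_prop

theorem star_planeWave (x ω : V) : star (planeWave x ω) = planeWave x (-ω) := by
  simp only [planeWave, RCLike.star_def, ← Complex.exp_conj, map_mul, Complex.conj_I,
    Complex.conj_ofReal, inner_neg_right]
  congr 1
  push_cast
  ring

theorem star_planeWave_mul (x y ω : V) :
    star (planeWave x ω) * planeWave y ω = star (planeWave (x - y) ω) := by
  rw [star_planeWave, star_planeWave]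
  simp only [planeWave, ← Complex.exp_add, inner_neg_right, inner_sub_left]
  congr 1
  push_cast
  ring

/-- Distinct characters are linearly independent (Dedekind), so it only remains to separate
different `x`. -/
theorem linearIndependent_planeWave :
    LinearIndependent ℂ (planeWave : V → V → ℂ) := by
  let χ : V → (Multiplicative V →* ℂ) := fun x =>
    { toFun := fun ω => planeWave x ω.toAdd
      map_one' := by simp [planeWave]
      map_mul' := fun a b => by
        simp only [planeWave, toAdd_mul, inner_add_right, ← Complex.exp_add]
        congr 1
        push_cast
        ring }
  have hχ : Function.Injective χ := by
    intro x y hxy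
    by_contra hne
    have h0 : (0 : ℝ) < ‖x - y‖ ^ 2 := by
      have := sub_ne_zero.2 hne
      positivity
    -- At this frequency the two characters differ by the factor `exp (π i) = -1`.
    set ω : V := (1 / (2 * ‖x - y‖ ^ 2) : ℝ) • (x - y) with hω
    have h1 : planeWave x ω = planeWave y ω := DFunLike.congr_fun hxy (Multiplicative.ofAdd ω)
    have h2 : star (planeWave (x - y) ω) = 1 := by
      rw [← star_planeWave_mul, ← h1, RCLike.star_def, mul_comm, Complex.mul_conj,
        Complex.normSq_eq_norm_sq, norm_planeWave]
      simp
    have h3 : inner ℝ (x - y) (-ω) = -(1 / 2 : ℝ) := by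
      rw [hω, inner_neg_right, inner_smul_right, real_inner_self_eq_norm_sq]
      have := (norm_pos_iff.2 (sub_ne_zero.2 hne)).ne'
      field_simp
    rw [star_planeWave, planeWave, h3] at h2
    have : ((-(2 * Real.pi * -(1 / 2)) : ℝ) : ℂ) * Complex.I = Real.pi * Complex.I := by
      push_cast; ring
    rw [this, Complex.exp_pi_mul_I] at h2
    norm_num at h2
  exact (linearIndependent_monoidHom (Multiplicative V) ℂ).comp χ hχ

variable [FiniteDimensional ℝ V] [MeasurableSpace V] [BorelSpace V]

theorem fourierInv_eq_integral_planeWave (w : V → ℂ) (x : V) :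
    𝓕⁻ w x = ∫ ω, star (planeWave x ω) * w ω := by
  rw [Real.fourierInv_eq']
  congr 1
  ext ω
  rw [star_planeWave, planeWave, smul_eq_mul, inner_neg_right, real_inner_comm]
  congr 3
  push_cast
  ring

/-- `K` is the translation invariant kernel whose Fourier transform is the nonnegative integrable
function `m`, which does not vanish on a set of positive measure. -/
structure IsSpectralDensity (K : V → V → ℝ) (m : V → ℝ) : Prop where
  continuous : Continuous m
  nonneg : ∀ ω, 0 ≤ m ω
  even : ∀ ω, m (-ω) = m ω
  integrable : Integrable m
  ae_ne_zero : ∀ᵐ ω, m ω ≠ 0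
  kernel_eq : ∀ x y, (K x y : ℂ) = 𝓕⁻ (fun ω => (m ω : ℂ)) (x - y)

namespace IsSpectralDensity

variable {K : V → V → ℝ} {m : V → ℝ} (hm : IsSpectralDensity K m)
include hm

theorem memLp_sqrt_mul_planeWave (x : V) :
    MemLp (fun ω => (√(m ω) : ℂ) * planeWave x ω) 2 := by
  have hmeas : AEStronglyMeasurable (fun ω => (√(m ω) : ℂ) * planeWave x ω) volume := by
    have := hm.continuous
    have := continuous_planeWave x
    exact Continuous.aestronglyMeasurable (by fun_prop)
  rw [memLp_two_iff_integrable_sq_norm hmeas]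
  refine hm.integrable.congr (ae_of_all _ fun ω => ?_)
  simp only [norm_mul, norm_planeWave, mul_one, Complex.norm_real, Real.norm_eq_abs, sq_abs]
  rw [Real.sq_sqrt (hm.nonneg ω)]

/-- The feature map of the kernel `K` into `L²`. -/
noncomputable def feature (x : V) : Lp ℂ 2 (volume : Measure V) :=
  (hm.memLp_sqrt_mul_planeWave x).toLp

theorem inner_feature_left (x : V) (u : Lp ℂ 2 (volume : Measure V)) :
    inner ℂ (hm.feature x) u = 𝓕⁻ (fun ω => (√(m ω) : ℂ) * u ω) x := by
  rw [L2.inner_def, fourierInv_eq_integral_planeWave]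
  refine integral_congr_ae ?_
  filter_upwards [(hm.memLp_sqrt_mul_planeWave x).coeFn_toLp] with ω hω
  rw [feature, hω, RCLike.inner_apply, map_mul, Complex.conj_ofReal, RCLike.star_def]
  ring

theorem inner_feature (x y : V) : inner ℂ (hm.feature x) (hm.feature y) = (K x y : ℂ) := by
  rw [inner_feature_left, hm.kernel_eq, fourierInv_eq_integral_planeWave,
    fourierInv_eq_integral_planeWave]
  refine integral_congr_ae ?_
  filter_upwards [(hm.memLp_sqrt_mul_planeWave y).coeFn_toLp] with ω hω
  rw [feature, hω, ← star_planeWave_mul]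
  have : (m ω : ℂ) = √(m ω) * √(m ω) := by
    rw [← Complex.ofReal_mul, Real.mul_self_sqrt (hm.nonneg ω)]
  rw [this]
  ring

theorem sum_sum_mul_kernel (S : Finset V) (c : V → ℝ) :
    ∑ x ∈ S, ∑ y ∈ S, c x * c y * K x y = ‖∑ x ∈ S, (c x : ℂ) • hm.feature x‖ ^ 2 := by
  have h := inner_self_eq_norm_sq_to_K (𝕜 := ℂ) (∑ x ∈ S, (c x : ℂ) • hm.feature x)
  have h2 : inner ℂ (∑ x ∈ S, (c x : ℂ) • hm.feature x) (∑ x ∈ S, (c x : ℂ) • hm.feature x)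
      = ((∑ x ∈ S, ∑ y ∈ S, c x * c y * K x y : ℝ) : ℂ) := by
    rw [sum_inner]
    push_cast
    refine Finset.sum_congr rfl fun x _ => ?_
    rw [inner_sum]
    refine Finset.sum_congr rfl fun y _ => ?_
    rw [inner_smul_left, inner_smul_right, inner_feature, Complex.conj_ofReal]
    ring
  rw [h2] at h
  refine Complex.ofReal_injective ?_
  rw [h]
  simp

theorem coeFn_sum_smul_feature (S : Finset V) (c : V → ℂ) :
    (∑ x ∈ S, c x • hm.feature x : Lp ℂ 2 (volume : Measure V)) =ᵐ[volume]
      fun ω => (√(m ω) : ℂ) * ∑ x ∈ S, c x * planeWave x ω := by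
  classical
  induction S using Finset.induction_on with
  | empty =>
    filter_upwards [Lp.coeFn_zero ℂ 2 (volume : Measure V)] with ω hω
    simp
  | insert a S ha ih =>
    rw [Finset.sum_insert ha]
    filter_upwards [Lp.coeFn_add (c a • hm.feature a) (∑ x ∈ S, c x • hm.feature x),
      Lp.coeFn_smul (c a) (hm.feature a), (hm.memLp_sqrt_mul_planeWave a).coeFn_toLp, ih]
      with ω h₁ h₂ h₃ h₄
    rw [h₁, Pi.add_apply, h₂, Pi.smul_apply, h₄, feature, h₃, Finset.sum_insert ha, smul_eq_mul]
    ring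

/-- The quadratic form is the squared norm of `√m` times a trigonometric sum. If it vanishes, so
does the sum almost everywhere, then everywhere by continuity, and independence of the characters
kills the coefficients. -/
theorem isPosDefKernel : IsPosDefKernel K where
  symm x y := by
    have h := inner_conj_symm (𝕜 := ℂ) (hm.feature x) (hm.feature y)
    rw [hm.inner_feature, hm.inner_feature, Complex.conj_ofReal] at h
    exact_mod_cast h.symm
  pos S c hc := by
    rw [hm.sum_sum_mul_kernel]
    refine pow_pos (norm_pos_iff.2 fun h0 => ?_) 2
    have h1 := hm.coeFn_sum_smul_feature S (fun x => (c x : ℂ))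
    rw [h0] at h1
    have h2 : (fun ω => ∑ x ∈ S, (c x : ℂ) * planeWave x ω) =ᵐ[volume] fun _ => 0 := by
      filter_upwards [h1, Lp.coeFn_zero ℂ 2 (volume : Measure V), hm.ae_ne_zero] with ω h₁ h₂ h₃
      rw [h₂, Pi.zero_apply] at h₁
      refine (mul_eq_zero.1 h₁.symm).resolve_left ?_
      have := (hm.nonneg ω).lt_of_ne' h₃
      exact_mod_cast (Real.sqrt_pos.2 this).ne'
    have h3 : (fun ω => ∑ x ∈ S, (c x : ℂ) * planeWave x ω) = fun _ => 0 :=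
      Continuous.ae_eq_iff_eq volume
        (continuous_finsetSum _ fun x _ => continuous_const.mul (continuous_planeWave x))
        continuous_const |>.1 h2
    obtain ⟨x, hx, hcx⟩ := hc
    refine hcx ?_
    have h4 := linearIndependent_iff'.1 (linearIndependent_planeWave (V := V)) S
      (fun x => (c x : ℂ)) (by
        ext ω
        simp [congrFun h3 ω]) x hx
    exact_mod_cast h4

end IsSpectralDensity

/-- A real positive definite kernel has a native space. -/
theorem IsPosDefKernel.exists_isNativeSpace {X : Type} {K : X → X → ℝ} (hK : IsPosDefKernel K) :
    ∃ (H : Type) (_ : NormedAddCommGroup H) (_ : InnerProductSpace ℝ H) (_ : CompleteSpace H)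
        (_ : RKHS ℝ H X ℝ), IsNativeSpace K H := by
  let M : Matrix X X (ℝ →L[ℝ] ℝ) := .of fun x y => K x y • ContinuousLinearMap.id ℝ ℝ
  have hM : M.PosSemidef := by
    refine (RKHS.posSemidef_tfae (K := M)).out 0 2 |>.2 ?_
    refine ⟨?_, fun f => ?_⟩
    · ext x y
      simp [M, Matrix.conjTranspose_apply, hK.symm x y, ContinuousLinearMap.star_eq_adjoint,
        ContinuousLinearMap.adjoint_id]
    · have h : 0 ≤ ∑ x ∈ f.support, ∑ y ∈ f.support, f x * f y * K x y := by
        by_cases h0 : ∃ x ∈ f.support, f x ≠ 0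
        · exact (hK.pos f.support f h0).le
        · push Not at h0
          refine Finset.sum_nonneg fun x hx => Finset.sum_nonneg fun y hy => ?_
          simp [h0 x hx]
      simp only [Finsupp.sum, M, Matrix.of_apply, RCLike.re_to_real]
      refine h.trans_eq (Finset.sum_congr rfl fun x _ => Finset.sum_congr rfl fun y _ => ?_)
      simp [hK.symm x y]
      ring
  have : Fact M.PosSemidef := ⟨hM⟩
  refine ⟨RKHS.OfKernel M, inferInstance, inferInstance, inferInstance, inferInstance, hK,
    fun x y => ?_⟩
  rw [RKHS.OfKernel.kernel_ofKernel]
  simp [M]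

end SpectralDensity

/-! ### Members of the native space as inverse Fourier transforms. -/

section NativeSpace

variable {X : Type*} {H : Type*} [NormedAddCommGroup H] [InnerProductSpace ℝ H] [CompleteSpace H]
  [RKHS ℝ H X ℝ]

theorem IsNativeSpace.inner_kerFun {K : X → X → ℝ} (hH : IsNativeSpace K H) (x y : X) :
    inner ℝ (RKHS.kerFun H x 1) (RKHS.kerFun H y 1) = K x y := by
  rw [RKHS.kerFun_inner, RKHS.kerFun_apply, hH.kernel_eq]
  simp

theorem dense_range_linearCombination_kerFun :
    Dense (Set.range (Finsupp.linearCombination ℝ fun x : X => RKHS.kerFun H x 1)) := by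
  have h := RKHS.kerFun_dense (H := H)
  have hsub : Submodule.span ℝ {RKHS.kerFun H x v | (x) (v)} ≤
      LinearMap.range (Finsupp.linearCombination ℝ fun x : X => RKHS.kerFun H x 1) := by
    refine Submodule.span_le.2 ?_
    rintro _ ⟨x, v, rfl⟩
    refine ⟨Finsupp.single x v, ?_⟩
    rw [Finsupp.linearCombination_single, ← map_smul]
    simp
  have h2 := Submodule.topologicalClosure_mono hsub
  rw [h, top_le_iff] at h2
  exact (Submodule.dense_iff_topologicalClosure_eq_top).2 h2

end NativeSpace

section NativeSpace

variable {V : Type*} [NormedAddCommGroup V] [InnerProductSpace ℝ V] [FiniteDimensional ℝ V]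
  [MeasurableSpace V] [BorelSpace V] {K : V → V → ℝ} {m : V → ℝ}
  {H : Type*} [NormedAddCommGroup H] [InnerProductSpace ℝ H] [CompleteSpace H] [RKHS ℝ H V ℝ]

/-- Kernel sections and features have the same Gram matrix, so sending one to the other is isometric
on finite combinations. A sequence of combinations converging to `h` therefore has a convergent
image, with limit `u`; continuity of point evaluations identifies the values. -/
theorem IsSpectralDensity.exists_eq_inner_feature (hm : IsSpectralDensity K m)
    (hH : IsNativeSpace K H) (h : H) :
    ∃ u : Lp ℂ 2 (volume : Measure V), ∀ x, (h x : ℂ) = inner ℂ (hm.feature x) u := by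
  set S := Finsupp.linearCombination ℝ fun x : V => RKHS.kerFun H x 1 with hS
  set Q := Finsupp.linearCombination ℝ hm.feature with hQ
  have hQ' : ∀ c : V →₀ ℝ, Q c = ∑ x ∈ c.support, (c x : ℂ) • hm.feature x := fun c => by
    simp only [hQ, Finsupp.linearCombination_apply, Finsupp.sum]
    exact Finset.sum_congr rfl fun x _ => (algebraMap_smul ℂ (c x) (hm.feature x)).symm
  have hnorm : ∀ c, ‖Q c‖ = ‖S c‖ := fun c => by
    rw [← sq_eq_sq₀ (norm_nonneg _) (norm_nonneg _), hQ', ← hm.sum_sum_mul_kernel,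
      ← real_inner_self_eq_norm_sq]
    simp only [hS, Finsupp.linearCombination_apply, Finsupp.sum]
    rw [sum_inner]
    refine Finset.sum_congr rfl fun x _ => ?_
    rw [inner_sum]
    refine Finset.sum_congr rfl fun y _ => ?_
    rw [inner_smul_left, inner_smul_right, hH.inner_kerFun]
    simp [mul_assoc]
  have heval : ∀ c x, ((S c) x : ℂ) = inner ℂ (hm.feature x) (Q c) := fun c x => by
    have h1 : (S c) x = ∑ y ∈ c.support, c y * K x y := by
      have : (S c) x = inner ℝ (RKHS.kerFun H x 1) (S c) := by simp
      rw [this]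
      simp only [hS, Finsupp.linearCombination_apply, Finsupp.sum]
      rw [inner_sum]
      refine Finset.sum_congr rfl fun y _ => ?_
      rw [inner_smul_right, hH.inner_kerFun]
    rw [h1, hQ', inner_sum]
    push_cast
    refine Finset.sum_congr rfl fun y _ => ?_
    rw [inner_smul_right, hm.inner_feature]
  obtain ⟨s, hs, hlim⟩ := mem_closure_iff_seq_limit.1
    (dense_range_linearCombination_kerFun (X := V) h)
  choose c hc using hs
  have hcau : CauchySeq fun n => Q (c n) := by
    have h1 := hlim.cauchySeq
    rw [Metric.cauchySeq_iff'] at h1 ⊢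
    intro ε hε
    obtain ⟨N, hN⟩ := h1 ε hε
    refine ⟨N, fun n hn => ?_⟩
    have h2 := hN n hn
    rwa [dist_eq_norm, ← hc, ← hc, ← map_sub, ← hnorm, map_sub, ← dist_eq_norm] at h2
  obtain ⟨u, hu⟩ := cauchySeq_tendsto_of_complete hcau
  refine ⟨u, fun x => ?_⟩
  have l1 : Tendsto (fun n => ((s n) x : ℂ)) atTop (𝓝 (h x : ℂ)) :=
    (Complex.continuous_ofReal.tendsto _).comp
      (((RKHS.continuous_eval x).tendsto h).comp hlim)
  have l2 : Tendsto (fun n => inner ℂ (hm.feature x) (Q (c n))) atTop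
      (𝓝 (inner ℂ (hm.feature x) u)) := (tendsto_const_nhds (x := hm.feature x)).inner hu
  refine tendsto_nhds_unique l1 (l2.congr fun n => ?_)
  rw [← heval, ← hc]

end NativeSpace

/-! ### Containment in the Sobolev space. -/

section Sobolev

variable {d : ℕ} {K : EuclideanSpace ℝ (Fin d) → EuclideanSpace ℝ (Fin d) → ℝ}
  {m : EuclideanSpace ℝ (Fin d) → ℝ}
  {H : Type*} [NormedAddCommGroup H] [InnerProductSpace ℝ H] [CompleteSpace H]
  [RKHS ℝ H (EuclideanSpace ℝ (Fin d)) ℝ]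

theorem one_le_one_add_norm_sq (ω : EuclideanSpace ℝ (Fin d)) :
    1 ≤ 1 + ‖(2 * Real.pi) • ω‖ ^ 2 := by
  have := sq_nonneg ‖(2 * Real.pi) • ω‖
  linarith

theorem continuous_sobolevWeight (s : ℝ) : Continuous fun ω : EuclideanSpace ℝ (Fin d) =>
    (1 + ‖(2 * Real.pi) • ω‖ ^ 2) ^ s := by
  refine Continuous.rpow_const (by fun_prop) fun ω => Or.inl ?_
  have := one_le_one_add_norm_sq ω
  positivity

namespace IsSpectralDensity

variable (hm : IsSpectralDensity K m) {C p s : ℝ}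
  (hC : ∀ ω, m ω ≤ C * (1 + ‖(2 * Real.pi) • ω‖ ^ 2) ^ (-p))
include hm hC

/-- The single place where the order `s` is compared with the decay exponent `p`, which is `ℓ + 1`
for the Wu kernel. -/
theorem sobolevWeight_mul_le (hsp : s ≤ p) (ω : EuclideanSpace ℝ (Fin d)) :
    (1 + ‖(2 * Real.pi) • ω‖ ^ 2) ^ s * m ω ≤ C := by
  have h1 := one_le_one_add_norm_sq ω
  have hC0 : 0 ≤ C := by
    have := (hm.nonneg ω).trans (hC ω)
    have h2 : 0 < (1 + ‖(2 * Real.pi) • ω‖ ^ 2) ^ (-p) := by positivity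
    exact nonneg_of_mul_nonneg_left this h2
  calc (1 + ‖(2 * Real.pi) • ω‖ ^ 2) ^ s * m ω
      ≤ (1 + ‖(2 * Real.pi) • ω‖ ^ 2) ^ p * (C * (1 + ‖(2 * Real.pi) • ω‖ ^ 2) ^ (-p)) :=
        mul_le_mul (Real.rpow_le_rpow_of_exponent_le h1 hsp) (hC ω) (hm.nonneg ω) (by positivity)
    _ = C := by
        rw [Real.rpow_neg (by positivity)]
        field_simp

theorem sobolevWeight_mul_sqrt_le (hsp : s ≤ p) (ω : EuclideanSpace ℝ (Fin d)) :
    (1 + ‖(2 * Real.pi) • ω‖ ^ 2) ^ (s / 2) * √(m ω) ≤ √C := by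
  refine Real.le_sqrt_of_sq_le ?_
  have h1 := one_le_one_add_norm_sq ω
  rw [mul_pow, Real.sq_sqrt (hm.nonneg ω), ← Real.rpow_natCast, ← Real.rpow_mul (by positivity)]
  have : s / 2 * ((2 : ℕ) : ℝ) = s := by push_cast; ring
  rw [this]
  exact hm.sobolevWeight_mul_le hC hsp ω

theorem memLp_sobolevWeight_mul_sqrt_mul (hsp : s ≤ p) {u : EuclideanSpace ℝ (Fin d) → ℂ}
    (hu : MemLp u 2) : MemLp (fun ω => (((1 + ‖(2 * Real.pi) • ω‖ ^ 2) ^ (s / 2) : ℝ) : ℂ) *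
      ((√(m ω) : ℂ) * u ω)) 2 := by
  have hc := continuous_sobolevWeight (d := d) (s / 2)
  have hmc := hm.continuous
  refine hu.of_le_mul (c := √C) ?_ (ae_of_all _ fun ω => ?_)
  · exact (Complex.continuous_ofReal.comp hc).aestronglyMeasurable.mul
      ((Continuous.aestronglyMeasurable (by fun_prop)).mul hu.1)
  · have h1 := one_le_one_add_norm_sq ω
    rw [norm_mul, norm_mul, Complex.norm_real, Complex.norm_real,
      Real.norm_of_nonneg (by positivity), Real.norm_of_nonneg (by positivity), ← mul_assoc]
    gcongr
    exact hm.sobolevWeight_mul_sqrt_le hC hsp ω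

theorem memLp_sqrt_mul (hp : 0 ≤ p) {u : EuclideanSpace ℝ (Fin d) → ℂ}
    (hu : MemLp u 2) : MemLp (fun ω => (√(m ω) : ℂ) * u ω) 2 := by
  simpa using hm.memLp_sobolevWeight_mul_sqrt_mul hC (s := 0) hp hu

omit hC in
theorem integrable_sqrt_mul {u : EuclideanSpace ℝ (Fin d) → ℂ}
    (hu : MemLp u 2) : Integrable (fun ω => (√(m ω) : ℂ) * u ω) := by
  -- At `x = 0` the character is `1`, so `√m ∈ L²`, and a product of two `L²` functions is
  -- integrable.
  have h := hm.memLp_sqrt_mul_planeWave 0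
  simp only [planeWave, inner_zero_left, mul_zero, neg_zero, Complex.ofReal_zero, zero_mul,
    Complex.exp_zero, mul_one] at h
  exact h.integrable_mul hu

theorem exists_memSobolevReal_of_mem_nativeSpace (hH : IsNativeSpace K H) (hp : 0 ≤ p)
    (hsp : s ≤ p) (h : H) : ∃ F : Lp ℝ 2 (volume : Measure (EuclideanSpace ℝ (Fin d))),
      F =ᵐ[volume] (fun x => h x) ∧ MemSobolevReal s F := by
  obtain ⟨u, hu⟩ := hm.exists_eq_inner_feature hH h
  obtain ⟨F, hF, hF'⟩ := exists_fourierReal_ae_eq (hm.integrable_sqrt_mul (Lp.memLp u))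
    (hm.memLp_sqrt_mul hC hp (Lp.memLp u)) (f := fun x => h x)
    (fun x => by rw [hu, hm.inner_feature_left])
  refine ⟨F, hF, ?_⟩
  refine (hm.memLp_sobolevWeight_mul_sqrt_mul hC hsp (Lp.memLp u)).ae_eq ?_
  filter_upwards [hF'] with ω hω
  rw [hω]

end IsSpectralDensity

end Sobolev

/-! ### Density in the Sobolev space. -/

section SobolevDensity

variable {d : ℕ} {K : EuclideanSpace ℝ (Fin d) → EuclideanSpace ℝ (Fin d) → ℝ}
  {m : EuclideanSpace ℝ (Fin d) → ℝ}
  {H : Type*} [NormedAddCommGroup H] [InnerProductSpace ℝ H] [CompleteSpace H]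
  [RKHS ℝ H (EuclideanSpace ℝ (Fin d)) ℝ]

theorem sobolevNorm_lt_of_integral_lt {s : ℝ}
    {F : Lp ℝ 2 (volume : Measure (EuclideanSpace ℝ (Fin d)))}
    {ε : ℝ} (hε : 0 < ε)
    (h : ∫ ω, ‖(((1 + ‖(2 * Real.pi) • ω‖ ^ 2) ^ (s / 2) : ℝ) : ℂ) * fourierReal F ω‖ ^ 2 < ε ^ 2) :
    sobolevNorm s F < ε := by
  rw [sobolevNorm, Real.sqrt_lt' hε]
  have e : ∀ ω : EuclideanSpace ℝ (Fin d),
      ‖fourierReal F ω‖ ^ 2 * (1 + ‖(2 * Real.pi) • ω‖ ^ 2) ^ s =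
      ‖(((1 + ‖(2 * Real.pi) • ω‖ ^ 2) ^ (s / 2) : ℝ) : ℂ) * fourierReal F ω‖ ^ 2 := by
    intro ω
    have h1 := one_le_one_add_norm_sq ω
    have h2 : s / 2 * ((2 : ℕ) : ℝ) = s := by push_cast; ring
    rw [norm_mul, Complex.norm_real, Real.norm_of_nonneg (by positivity), mul_pow,
      ← Real.rpow_natCast _ 2, ← Real.rpow_natCast _ 2, ← Real.rpow_natCast _ 2,
      ← Real.rpow_mul (by positivity), h2, mul_comm]
  simp only [e]
  refine lt_of_le_of_lt ?_ h
  -- The normalizing factor `(2π)^(-d/2)` is at most `1` and can be dropped.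
  refine mul_le_of_le_one_left (integral_nonneg fun ω => by positivity) ?_
  refine Real.rpow_le_one_of_one_le_of_nonpos ?_ ?_
  · have := Real.pi_gt_three
    linarith
  · have : (0 : ℝ) ≤ d := Nat.cast_nonneg d
    linarith

namespace IsSpectralDensity

variable (hm : IsSpectralDensity K m) {C p s : ℝ}
  (hC : ∀ ω, m ω ≤ C * (1 + ‖(2 * Real.pi) • ω‖ ^ 2) ^ (-p))
include hm

theorem sum_kernel_eq_fourierInv (S : Finset (EuclideanSpace ℝ (Fin d)))
    (c : EuclideanSpace ℝ (Fin d) → ℝ) (y : EuclideanSpace ℝ (Fin d)) :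
    ((∑ x ∈ S, c x * K y x : ℝ) : ℂ) = 𝓕⁻ (fun ω => (√(m ω) : ℂ) *
      ((√(m ω) : ℂ) * ∑ x ∈ S, (c x : ℂ) * planeWave x ω)) y := by
  have h1 : ((∑ x ∈ S, c x * K y x : ℝ) : ℂ) =
      inner ℂ (hm.feature y) (∑ x ∈ S, (c x : ℂ) • hm.feature x) := by
    rw [inner_sum]
    push_cast
    refine Finset.sum_congr rfl fun x _ => ?_
    rw [inner_smul_right, hm.inner_feature]
  rw [h1, hm.inner_feature_left]
  refine Real.fourierInv_congr_ae ?_ y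
  filter_upwards [hm.coeFn_sum_smul_feature S (fun x => (c x : ℂ))] with ω hω
  rw [hω]

theorem memLp_sqrt_mul_sum (S : Finset (EuclideanSpace ℝ (Fin d)))
    (c : EuclideanSpace ℝ (Fin d) → ℂ) :
    MemLp (fun ω => (√(m ω) : ℂ) * ∑ x ∈ S, c x * planeWave x ω) 2 := by
  refine MemLp.ae_eq (hm.coeFn_sum_smul_feature S c) (Lp.memLp _)

include hC

/-- The function `(1 + ‖ω‖ ^ 2) ^ (s / 2) K(·, x)^(ω)` in `L²`. -/
noncomputable def weightedFeature (hsp : s ≤ p) (x : EuclideanSpace ℝ (Fin d)) :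
    Lp ℂ 2 (volume : Measure (EuclideanSpace ℝ (Fin d))) :=
  (hm.memLp_sobolevWeight_mul_sqrt_mul hC hsp (hm.memLp_sqrt_mul_planeWave x)).toLp

theorem coeFn_sum_smul_weightedFeature (hsp : s ≤ p) (S : Finset (EuclideanSpace ℝ (Fin d)))
    (c : EuclideanSpace ℝ (Fin d) → ℂ) :
    (∑ x ∈ S, c x • hm.weightedFeature hC hsp x :
      Lp ℂ 2 (volume : Measure (EuclideanSpace ℝ (Fin d)))) =ᵐ[volume]
      fun ω => (((1 + ‖(2 * Real.pi) • ω‖ ^ 2) ^ (s / 2) : ℝ) : ℂ) * ((√(m ω) : ℂ) *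
        ((√(m ω) : ℂ) * ∑ x ∈ S, c x * planeWave x ω)) := by
  classical
  induction S using Finset.induction_on with
  | empty =>
    filter_upwards [Lp.coeFn_zero ℂ 2 (volume : Measure (EuclideanSpace ℝ (Fin d)))] with ω hω
    simp
  | insert a S ha ih =>
    rw [Finset.sum_insert ha]
    filter_upwards [Lp.coeFn_add (c a • hm.weightedFeature hC hsp a)
        (∑ x ∈ S, c x • hm.weightedFeature hC hsp x),
      Lp.coeFn_smul (c a) (hm.weightedFeature hC hsp a),
      (hm.memLp_sobolevWeight_mul_sqrt_mul hC hsp (hm.memLp_sqrt_mul_planeWave a)).coeFn_toLp, ih]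
      with ω h₁ h₂ h₃ h₄
    rw [h₁, Pi.add_apply, h₂, Pi.smul_apply, h₄, weightedFeature, h₃, Finset.sum_insert ha,
      smul_eq_mul]
    ring

/-- Orthogonality of `v` to every generator says that the integrable function `q v`, with `q` the
weight times `m`, has zero inverse transform. So `q v = 0` almost everywhere, and `q` is almost
nowhere zero. -/
theorem dense_span_weightedFeature (hsp : s ≤ p) :
    (Submodule.span ℂ (Set.range (hm.weightedFeature hC hsp))).topologicalClosure = ⊤ := by
  rw [Submodule.topologicalClosure_eq_top_iff, Submodule.eq_bot_iff]
  intro v hv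
  set q : EuclideanSpace ℝ (Fin d) → ℂ := fun ω =>
    (((1 + ‖(2 * Real.pi) • ω‖ ^ 2) ^ (s / 2) : ℝ) : ℂ) * ((√(m ω) : ℂ) * (√(m ω) : ℂ)) with hq
  have hq2 : MemLp q 2 := by
    have := hm.memLp_sobolevWeight_mul_sqrt_mul hC hsp (hm.memLp_sqrt_mul_planeWave 0)
    simpa [planeWave, hq] using this
  have hint : Integrable (fun ω => q ω * v ω) := hq2.integrable_mul (Lp.memLp v)
  have h0 : ∀ x, 𝓕⁻ (fun ω => q ω * v ω) x = 0 := by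
    intro x
    have h1 : inner ℂ (hm.weightedFeature hC hsp x) v = 0 :=
      (Submodule.mem_orthogonal _ _).1 hv _ (Submodule.subset_span ⟨x, rfl⟩)
    rw [← h1, L2.inner_def, fourierInv_eq_integral_planeWave]
    refine integral_congr_ae ?_
    filter_upwards [(hm.memLp_sobolevWeight_mul_sqrt_mul hC hsp
      (hm.memLp_sqrt_mul_planeWave x)).coeFn_toLp] with ω hω
    rw [weightedFeature, hω, RCLike.inner_apply]
    simp only [map_mul, Complex.conj_ofReal, RCLike.star_def, hq]
    ring
  refine Lp.ext ?_
  filter_upwards [ae_eq_zero_of_fourierInv_eq_zero hint h0, hm.ae_ne_zero,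
    Lp.coeFn_zero ℂ 2 (volume : Measure (EuclideanSpace ℝ (Fin d)))] with ω h₁ h₂ h₃
  rw [h₃]
  refine (mul_eq_zero.1 h₁).resolve_left ?_
  have h4 := one_le_one_add_norm_sq ω
  have h5 : 0 < √(m ω) := Real.sqrt_pos.2 ((hm.nonneg ω).lt_of_ne' h₂)
  have h6 : 0 < (1 + ‖(2 * Real.pi) • ω‖ ^ 2) ^ (s / 2) := by positivity
  simp only [hq]
  exact mul_ne_zero (by exact_mod_cast h6.ne')
    (mul_ne_zero (by exact_mod_cast h5.ne') (by exact_mod_cast h5.ne'))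

theorem exists_sum_approx (hsp : s ≤ p) {a : EuclideanSpace ℝ (Fin d) → ℂ} (ha : MemLp a 2)
    {ε : ℝ} (hε : 0 < ε) :
    ∃ (S : Finset (EuclideanSpace ℝ (Fin d))) (c : EuclideanSpace ℝ (Fin d) → ℂ),
      MemLp (fun ω => a ω - (((1 + ‖(2 * Real.pi) • ω‖ ^ 2) ^ (s / 2) : ℝ) : ℂ) *
        ((√(m ω) : ℂ) * ((√(m ω) : ℂ) * ∑ x ∈ S, c x * planeWave x ω))) 2 ∧
      ∫ ω, ‖a ω - (((1 + ‖(2 * Real.pi) • ω‖ ^ 2) ^ (s / 2) : ℝ) : ℂ) * ((√(m ω) : ℂ) *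
        ((√(m ω) : ℂ) * ∑ x ∈ S, c x * planeWave x ω))‖ ^ 2 < ε ^ 2 := by
  have h1 : ha.toLp ∈ closure (Submodule.span ℂ (Set.range (hm.weightedFeature hC hsp)) :
      Set (Lp ℂ 2 (volume : Measure (EuclideanSpace ℝ (Fin d))))) := by
    rw [← Submodule.topologicalClosure_coe, hm.dense_span_weightedFeature hC hsp]
    trivial
  obtain ⟨b, hb, hdist⟩ := Metric.mem_closure_iff.1 h1 ε hε
  obtain ⟨c, rfl⟩ := Finsupp.mem_span_range_iff_exists_finsupp.1 hb
  refine ⟨c.support, c, ?_⟩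
  set D := ha.toLp - c.sum fun i a => a • hm.weightedFeature hC hsp i with hD
  have hDae : D =ᵐ[volume] fun ω => a ω - (((1 + ‖(2 * Real.pi) • ω‖ ^ 2) ^ (s / 2) : ℝ) : ℂ) *
      ((√(m ω) : ℂ) * ((√(m ω) : ℂ) * ∑ x ∈ c.support, c x * planeWave x ω)) := by
    filter_upwards [Lp.coeFn_sub ha.toLp (c.sum fun i a => a • hm.weightedFeature hC hsp i),
      ha.coeFn_toLp, hm.coeFn_sum_smul_weightedFeature hC hsp c.support c] with ω h₁ h₂ h₃
    rw [hD, h₁, Pi.sub_apply, h₂, Finsupp.sum, h₃]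
  refine ⟨(Lp.memLp D).ae_eq hDae, ?_⟩
  have h2 : ∫ ω, ‖D ω‖ ^ 2 = ‖D‖ ^ 2 := by
    have h3 := inner_self_eq_norm_sq_to_K (𝕜 := ℂ) D
    rw [L2.inner_def] at h3
    refine Complex.ofReal_injective ?_
    rw [← integral_complex_ofReal]
    refine Eq.trans ?_ (h3.trans ?_)
    · refine integral_congr_ae (ae_of_all _ fun ω => ?_)
      simp only [inner_self_eq_norm_sq_to_K]
      simp
    · simp
  rw [dist_eq_norm] at hdist
  have h3 : ∫ ω, ‖a ω - (((1 + ‖(2 * Real.pi) • ω‖ ^ 2) ^ (s / 2) : ℝ) : ℂ) * ((√(m ω) : ℂ) *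
        ((√(m ω) : ℂ) * ∑ x ∈ c.support, c x * planeWave x ω))‖ ^ 2 = ∫ ω, ‖D ω‖ ^ 2 := by
    refine integral_congr_ae ?_
    filter_upwards [hDae] with ω hω
    rw [hω]
  rw [h3, h2]
  gcongr

theorem isDenseInSobolev (hH : IsNativeSpace K H) (hp : 0 ≤ p) (hsp : s ≤ p) :
    IsDenseInSobolev s (Set.range fun (h : H) (x : EuclideanSpace ℝ (Fin d)) => h x) := by
  refine ⟨?_, fun G hG ε hε => ?_⟩
  · rintro _ ⟨h, rfl⟩
    exact hm.exists_memSobolevReal_of_mem_nativeSpace hC hH hp hsp h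
  obtain ⟨S, c, hD, hlt⟩ := hm.exists_sum_approx hC hsp hG hε
  set W : EuclideanSpace ℝ (Fin d) → ℂ := fun ω =>
    (((1 + ‖(2 * Real.pi) • ω‖ ^ 2) ^ (s / 2) : ℝ) : ℂ) with hW
  set D : EuclideanSpace ℝ (Fin d) → ℂ := fun ω => W ω * fourierReal G ω - W ω *
    ((√(m ω) : ℂ) * ((√(m ω) : ℂ) * ∑ x ∈ S, c x * planeWave x ω)) with hDdef
  -- The native space is real, so only the real parts of the complex coefficients are usable.
  set r : EuclideanSpace ℝ (Fin d) → ℝ := fun x => (c x).re with hr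
  have hw2 := hm.memLp_sqrt_mul_sum S (fun x => (r x : ℂ))
  obtain ⟨F, hF, hF'⟩ := exists_fourierReal_ae_eq (hm.integrable_sqrt_mul hw2)
    (hm.memLp_sqrt_mul hC hp hw2) (f := fun y => ∑ x ∈ S, r x * K y x)
    (hm.sum_kernel_eq_fourierInv S r)
  refine ⟨_, ⟨∑ x ∈ S, r x • RKHS.kerFun H x 1, rfl⟩, F, ?_, ?_, ?_⟩
  · refine hF.trans (ae_of_all _ fun y => ?_)
    have h1 : (∑ x ∈ S, r x • RKHS.kerFun H x 1) y
        = inner ℝ (RKHS.kerFun H y 1) (∑ x ∈ S, r x • RKHS.kerFun H x 1) := by simp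
    simp only [h1]
    rw [inner_sum]
    refine Finset.sum_congr rfl fun x _ => ?_
    rw [inner_smul_right, hH.inner_kerFun]
  · refine (hm.memLp_sobolevWeight_mul_sqrt_mul hC hsp hw2).ae_eq ?_
    filter_upwards [hF'] with ω hω
    rw [hω]
  · refine sobolevNorm_lt_of_integral_lt hε (lt_of_le_of_lt ?_ hlt)
    have hI : Integrable fun ω => ‖D ω‖ ^ 2 := (memLp_two_iff_integrable_sq_norm hD.1).1 hD
    have hI' : Integrable fun ω => ‖D (-ω)‖ ^ 2 := hI.comp_neg
    -- As `Ĝ` is Hermitian and `W`, `m` are even, the new error is the Hermitian part `(D(ω) + conj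
    -- D(-ω)) / 2` of the old one, whose `L²` norm is no larger.
    have key : ∀ᵐ ω, ‖W ω * fourierReal (G - F) ω‖ ^ 2
        ≤ 1 / 2 * ‖D ω‖ ^ 2 + 1 / 2 * ‖D (-ω)‖ ^ 2 := by
      rw [fourierReal_sub]
      filter_upwards [Lp.coeFn_sub (fourierReal G) (fourierReal F), hF', fourierReal_neg_ae_eq G]
        with ω h₁ h₂ h₃
      have e : W ω * (fourierReal G - fourierReal F) ω = 1 / 2 * (D ω + star (D (-ω))) := by
        have hc : ∀ x, (r x : ℂ) = 1 / 2 * (c x + star (c x)) := fun x => by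
          rw [RCLike.star_def, Complex.add_conj, hr]
          push_cast
          ring
        have hWn : W (-ω) = W ω := by simp only [hW, smul_neg, norm_neg]
        have hWs : star (W ω) = W ω := Complex.conj_ofReal _
        have hms : star ((√(m ω) : ℝ) : ℂ) = (√(m ω) : ℂ) := Complex.conj_ofReal _
        rw [h₁, Pi.sub_apply, h₂]
        simp only [hDdef, h₃, hm.even, hWn, star_sub, star_mul', star_star, hWs, hms, star_sum,
          star_planeWave, neg_neg]
        have hsum : ∑ x ∈ S, (r x : ℂ) * planeWave x ω = 1 / 2 * (∑ x ∈ S, c x * planeWave x ω +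
            ∑ x ∈ S, star (c x) * planeWave x ω) := by
          rw [← Finset.sum_add_distrib, Finset.mul_sum]
          refine Finset.sum_congr rfl fun x _ => ?_
          rw [hc]
          ring
        rw [hsum]
        ring
      rw [e, norm_mul, mul_pow]
      have h4 : ‖D ω + star (D (-ω))‖ ≤ ‖D ω‖ + ‖D (-ω)‖ :=
        (norm_add_le _ _).trans_eq (by rw [norm_star])
      have h5 : ‖(1 / 2 : ℂ)‖ = 1 / 2 := by norm_num
      rw [h5]
      nlinarith [norm_nonneg (D ω + star (D (-ω))), sq_nonneg (‖D ω‖ - ‖D (-ω)‖),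
        norm_nonneg (D ω), norm_nonneg (D (-ω)), pow_le_pow_left₀ (norm_nonneg _) h4 2]
    calc ∫ ω, ‖W ω * fourierReal (G - F) ω‖ ^ 2
        ≤ ∫ ω, (1 / 2 * ‖D ω‖ ^ 2 + 1 / 2 * ‖D (-ω)‖ ^ 2) :=
          integral_mono_of_nonneg (ae_of_all _ fun ω => by positivity)
            ((hI.const_mul _).add (hI'.const_mul _)) key
      _ = ∫ ω, ‖D ω‖ ^ 2 := by
          rw [integral_add (hI.const_mul _) (hI'.const_mul _), integral_const_mul,
            integral_const_mul, integral_neg_eq_self (fun ω => ‖D ω‖ ^ 2)]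
          ring

end IsSpectralDensity

end SobolevDensity

/-! ### The truncated power, its transform and the zeros of the latter. -/

section TruncPow

variable {ℓ : ℝ}

theorem truncPow_eq_indicator (ℓ : ℝ) :
    truncPow ℓ = (Set.Ioo (-1 : ℝ) 1).indicator fun x => (1 - x ^ 2) ^ ℓ := by
  ext x
  simp only [truncPow, Set.indicator, Set.mem_Ioo, abs_lt]

theorem truncPow_neg (ℓ x : ℝ) : truncPow ℓ (-x) = truncPow ℓ x := by
  simp [truncPow]

theorem truncPow_nonneg (ℓ x : ℝ) : 0 ≤ truncPow ℓ x := by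
  unfold truncPow
  split_ifs with h
  · have := sq_lt_one_iff_abs_lt_one x |>.2 h
    exact Real.rpow_nonneg (by linarith) _
  · exact le_rfl

theorem truncPow_le_indicator (hℓ : 0 ≤ ℓ) (x : ℝ) :
    truncPow ℓ x ≤ (Set.Ioo (-1 : ℝ) 1).indicator (fun _ => 1) x := by
  rw [truncPow_eq_indicator]
  refine Set.indicator_le_indicator' fun hx => ?_
  have := sq_lt_one_iff_abs_lt_one x |>.2 (abs_lt.2 hx)
  exact Real.rpow_le_one (by linarith) (by linarith [sq_nonneg x]) hℓ

theorem truncPow_le_one (hℓ : 0 ≤ ℓ) (x : ℝ) : truncPow ℓ x ≤ 1 :=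
  (truncPow_le_indicator hℓ x).trans (Set.indicator_le_self' (by simp) x)

theorem continuousAt_truncPow (ℓ : ℝ) {x : ℝ} (h1 : x ≠ 1) (h2 : x ≠ -1) :
    ContinuousAt (truncPow ℓ) x := by
  have hx : |x| ≠ 1 := fun h => by
    rcases (abs_eq zero_le_one).1 h with h | h <;> contradiction
  rcases hx.lt_or_gt with h | h
  · have hev : truncPow ℓ =ᶠ[𝓝 x] fun y => (1 - y ^ 2) ^ ℓ := by
      filter_upwards [continuous_abs.continuousAt.eventually_lt continuousAt_const h] with y hy
      simp [truncPow, hy]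
    refine ContinuousAt.congr ?_ hev.symm
    have := sq_lt_one_iff_abs_lt_one x |>.2 h
    exact ContinuousAt.rpow_const (by fun_prop) (Or.inl (by linarith))
  · have hev : truncPow ℓ =ᶠ[𝓝 x] fun _ => 0 := by
      filter_upwards [continuousAt_const.eventually_lt continuous_abs.continuousAt h] with y hy
      simp [truncPow, hy.le.not_gt]
    exact continuousAt_const.congr hev.symm

theorem measurable_truncPow (ℓ : ℝ) : Measurable (truncPow ℓ) := by
  rw [truncPow_eq_indicator]
  exact Measurable.indicator (by fun_prop) measurableSet_Ioo

theorem integrable_truncPow (hℓ : 0 ≤ ℓ) : Integrable (truncPow ℓ) := by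
  have h : Integrable ((Set.Ioo (-1 : ℝ) 1).indicator fun _ : ℝ => (1 : ℝ)) :=
    (integrable_indicator_iff measurableSet_Ioo).2 (integrableOn_const (by simp))
  refine h.mono' (measurable_truncPow ℓ).aestronglyMeasurable (ae_of_all _ fun x => ?_)
  rw [Real.norm_of_nonneg (truncPow_nonneg ℓ x)]
  exact truncPow_le_indicator hℓ x

theorem truncPow_eq_zero {x : ℝ} (hx : 1 ≤ |x|) : truncPow ℓ x = 0 := by
  simp [truncPow, hx.not_gt]

/-- The Fourier transform of the truncated power. -/
noncomputable def truncPowHat (ℓ t : ℝ) : ℝ :=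
  ∫ x, truncPow ℓ x * Real.cos (2 * Real.pi * t * x)

theorem integrable_truncPow_mul_exp (hℓ : 0 ≤ ℓ) (t : ℝ) :
    Integrable fun x : ℝ => (truncPow ℓ x : ℂ) * Complex.exp ((t * x : ℝ) * Complex.I) := by
  refine (integrable_truncPow hℓ).ofReal.mul_bdd (c := 1)
    (Continuous.aestronglyMeasurable (by fun_prop)) (ae_of_all _ fun x => ?_)
  rw [Complex.norm_exp_ofReal_mul_I]

theorem integral_truncPow_mul_exp (hℓ : 0 ≤ ℓ) (t : ℝ) :
    ∫ x, (truncPow ℓ x : ℂ) * Complex.exp ((t * x : ℝ) * Complex.I) =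
      ((∫ x, truncPow ℓ x * Real.cos (t * x) : ℝ) : ℂ) := by
  have h1 : ∫ x, (truncPow ℓ x : ℂ) * Complex.exp ((t * x : ℝ) * Complex.I) =
      ∫ x, (truncPow ℓ x : ℂ) * Complex.exp ((-(t * x) : ℝ) * Complex.I) := by
    rw [← integral_neg_eq_self]
    simp only [truncPow_neg, mul_neg]
  have h2 : Integrable fun x : ℝ =>
      (truncPow ℓ x : ℂ) * Complex.exp ((-(t * x) : ℝ) * Complex.I) := by
    simpa only [neg_mul] using integrable_truncPow_mul_exp hℓ (-t)
  have h3 := integral_add (integrable_truncPow_mul_exp hℓ t) h2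
  rw [← h1, ← two_mul] at h3
  have h4 : ∀ x : ℝ, (truncPow ℓ x : ℂ) * Complex.exp ((t * x : ℝ) * Complex.I) +
      (truncPow ℓ x : ℂ) * Complex.exp ((-(t * x) : ℝ) * Complex.I) =
      2 * ((truncPow ℓ x * Real.cos (t * x) : ℝ) : ℂ) := by
    intro x
    push_cast
    rw [Complex.cos]
    ring_nf
  simp only [h4] at h3
  rw [integral_const_mul, integral_complex_ofReal] at h3
  exact (mul_left_cancel₀ two_ne_zero h3).symm

theorem fourier_truncPow (hℓ : 0 ≤ ℓ) (t : ℝ) :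
    𝓕 (fun x => (truncPow ℓ x : ℂ)) t = truncPowHat ℓ t := by
  have h := integral_truncPow_mul_exp hℓ (-(2 * Real.pi * t))
  rw [Real.fourier_real_eq_integral_exp_smul, truncPowHat]
  simp only [neg_mul, Real.cos_neg] at h
  rw [← h]
  congr 1
  ext x
  rw [smul_eq_mul, mul_comm]
  congr 3
  push_cast
  ring

theorem truncPowHat_neg (ℓ t : ℝ) : truncPowHat ℓ (-t) = truncPowHat ℓ t := by
  simp [truncPowHat]

theorem abs_truncPowHat_le_two (hℓ : 0 ≤ ℓ) (t : ℝ) : |truncPowHat ℓ t| ≤ 2 := by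
  have h : Integrable ((Set.Ioo (-1 : ℝ) 1).indicator fun _ : ℝ => (1 : ℝ)) :=
    (integrable_indicator_iff measurableSet_Ioo).2 (integrableOn_const (by simp))
  calc |truncPowHat ℓ t| ≤ ∫ x, (Set.Ioo (-1 : ℝ) 1).indicator (fun _ => (1 : ℝ)) x := by
        rw [← Real.norm_eq_abs]
        refine norm_integral_le_of_norm_le h (ae_of_all _ fun x => ?_)
        rw [norm_mul, Real.norm_of_nonneg (truncPow_nonneg ℓ x)]
        exact (mul_le_of_le_one_right (truncPow_nonneg ℓ x) (Real.abs_cos_le_one _)).trans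
          (truncPow_le_indicator hℓ x)
    _ = 2 := by
        rw [integral_indicator measurableSet_Ioo]
        simp
        norm_num

theorem continuous_truncPowHat (hℓ : 0 ≤ ℓ) : Continuous (truncPowHat ℓ) := by
  have h : Continuous (𝓕 (fun x => (truncPow ℓ x : ℂ))) :=
    VectorFourier.fourierIntegral_continuous Real.continuous_fourierChar continuous_inner
      (integrable_truncPow hℓ).ofReal
  have h2 := Complex.continuous_re.comp h
  refine h2.congr fun t => ?_
  simp [fourier_truncPow hℓ]

/-- The support lies in `[-1, 1]`, where `exp (z x)` and its `z`-derivative are bounded by `exp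
(‖z₀‖ + 1)` for `z` in the unit ball around `z₀`. -/
theorem differentiable_integral_truncPow_mul_cexp (hℓ : 0 ≤ ℓ) :
    Differentiable ℂ fun z : ℂ => ∫ x : ℝ, (truncPow ℓ x : ℂ) * Complex.exp (z * x) := by
  intro z₀
  have hmeas : ∀ z : ℂ, AEStronglyMeasurable
      (fun x : ℝ => (truncPow ℓ x : ℂ) * Complex.exp (z * x)) := fun z =>
    (Complex.measurable_ofReal.comp (measurable_truncPow ℓ)).aestronglyMeasurable.mul
      (Continuous.aestronglyMeasurable (by fun_prop))
  have hbd : ∀ z : ℂ, ‖z‖ ≤ ‖z₀‖ + 1 → ∀ x : ℝ,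
      ‖(truncPow ℓ x : ℂ) * Complex.exp (z * x)‖ ≤ truncPow ℓ x * Real.exp (‖z₀‖ + 1) := by
    intro z hz x
    rw [norm_mul, Complex.norm_real, Real.norm_of_nonneg (truncPow_nonneg ℓ x)]
    by_cases hx : 1 ≤ |x|
    · simp [truncPow_eq_zero hx]
    refine mul_le_mul_of_nonneg_left ?_ (truncPow_nonneg ℓ x)
    rw [Complex.norm_exp]
    refine Real.exp_le_exp.2 ((Complex.re_le_norm _).trans ?_)
    rw [norm_mul, Complex.norm_real, Real.norm_eq_abs]
    push Not at hx
    nlinarith [norm_nonneg z, abs_nonneg x]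
  have hint : Integrable fun x => truncPow ℓ x * Real.exp (‖z₀‖ + 1) :=
    (integrable_truncPow hℓ).mul_const _
  refine ((hasDerivAt_integral_of_dominated_loc_of_deriv_le
    (F := fun (z : ℂ) (x : ℝ) => (truncPow ℓ x : ℂ) * Complex.exp (z * x))
    (F' := fun (z : ℂ) (x : ℝ) => (x : ℂ) * ((truncPow ℓ x : ℂ) * Complex.exp (z * x)))
    (bound := fun x => truncPow ℓ x * Real.exp (‖z₀‖ + 1))
    (Metric.ball_mem_nhds z₀ one_pos)
    (Eventually.of_forall hmeas) ?_ ?_ ?_ hint ?_).2).differentiableAt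
  · exact hint.mono' (hmeas z₀) (ae_of_all _ (hbd z₀ (by linarith)))
  · exact Complex.continuous_ofReal.aestronglyMeasurable.mul (hmeas z₀)
  · refine ae_of_all _ fun x z hz => ?_
    have hz' : ‖z‖ ≤ ‖z₀‖ + 1 := by
      have h1 : ‖z - z₀‖ < 1 := mem_ball_iff_norm.1 hz
      have h2 := norm_le_norm_add_norm_sub' z z₀
      linarith
    have h1 := hbd z hz' x
    rw [norm_mul, Complex.norm_real, Real.norm_eq_abs]
    by_cases hx : 1 ≤ |x|
    · simp [truncPow_eq_zero hx]
    · push Not at hx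
      nlinarith [norm_nonneg ((truncPow ℓ x : ℂ) * Complex.exp (z * x)), abs_nonneg x]
  · refine ae_of_all _ fun x z _ => ?_
    have h1 : HasDerivAt (fun z : ℂ => z * (x : ℂ)) (x : ℂ) z := by
      simpa using (hasDerivAt_id z).mul_const (x : ℂ)
    convert! (h1.cexp.const_mul (truncPow ℓ x : ℂ)) using 1
    ring

theorem truncPowHat_zero_pos (hℓ : 0 ≤ ℓ) : 0 < truncPowHat ℓ 0 := by
  have : truncPowHat ℓ 0 = ∫ x, truncPow ℓ x := by simp [truncPowHat]
  rw [this, integral_pos_iff_support_of_nonneg (truncPow_nonneg ℓ) (integrable_truncPow hℓ)]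
  have hsub : Set.Ioo (-1 : ℝ) 1 ⊆ Function.support (truncPow ℓ) := by
    intro x hx
    have h := sq_lt_one_iff_abs_lt_one x |>.2 (abs_lt.2 hx)
    rw [truncPow_eq_indicator, Function.mem_support, Set.indicator_of_mem hx]
    exact (Real.rpow_pos_of_pos (by linarith) _).ne'
  refine lt_of_lt_of_le ?_ (measure_mono hsub)
  simp

/-- The transform is an entire function restricted to the imaginary axis. That function is nonzero
at `0`, so its zeros are isolated and therefore countable. -/
theorem countable_truncPowHat_eq_zero (hℓ : 0 ≤ ℓ) : {t | truncPowHat ℓ t = 0}.Countable := by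
  set G : ℂ → ℂ := fun z => ∫ x : ℝ, (truncPow ℓ x : ℂ) * Complex.exp (z * x) with hG
  have hGt : ∀ t : ℝ, G (((2 * Real.pi * t : ℝ) : ℂ) * Complex.I) = truncPowHat ℓ t := by
    intro t
    rw [truncPowHat, ← integral_truncPow_mul_exp hℓ]
    simp only [hG]
    congr 1
    ext x
    congr 2
    push_cast
    ring
  have han : AnalyticOnNhd ℂ G Set.univ := fun z _ =>
    (differentiable_integral_truncPow_mul_cexp hℓ).analyticAt z
  have hc : (G ⁻¹' {0})ᶜ ∈ codiscrete ℂ := by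
    have h0 : G 0 ≠ 0 := by
      have := hGt 0
      simp only [mul_zero, Complex.ofReal_zero, zero_mul] at this
      rw [this]
      exact_mod_cast (truncPowHat_zero_pos hℓ).ne'
    exact han.preimage_zero_mem_codiscrete h0
  have hd := (compl_mem_codiscrete_iff.1 hc).2
  have hcount : (G ⁻¹' {0}).Countable :=
    (HereditarilyLindelofSpace.isLindelof _).countable_of_isDiscrete hd
  refine (hcount.preimage_of_injOn
    (f := fun t : ℝ => ((2 * Real.pi * t : ℝ) : ℂ) * Complex.I) ?_).mono ?_
  · intro a _ b _ hab
    have h1 : ((2 * Real.pi * a : ℝ) : ℂ) = ((2 * Real.pi * b : ℝ) : ℂ) :=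
      mul_right_cancel₀ Complex.I_ne_zero hab
    have h2 : 2 * Real.pi * a = 2 * Real.pi * b := by exact_mod_cast h1
    exact mul_left_cancel₀ (by positivity) h2
  · intro t ht
    simp only [Set.mem_preimage, Set.mem_singleton_iff, hGt]
    exact_mod_cast ht

end TruncPow

/-! ### Decay of the transform, and Fourier inversion for `f_ℓ * f_ℓ`. -/

section TruncPowDecay

variable {ℓ : ℝ}

theorem integral_truncPow_mul_exp_eq_intervalIntegral (ℓ ω : ℝ) :
    ∫ x, (truncPow ℓ x : ℂ) * Complex.exp ((ω * x : ℝ) * Complex.I) =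
      ∫ x : ℝ in (-1 : ℝ)..1, (1 - (x : ℂ) ^ 2) ^ (ℓ : ℂ) *
        Complex.exp (Complex.I * ω * x) := by
  rw [intervalIntegral.integral_of_le (by norm_num), integral_Ioc_eq_integral_Ioo,
    ← integral_indicator measurableSet_Ioo]
  congr 1
  ext x
  rw [truncPow_eq_indicator]
  by_cases hx : x ∈ Set.Ioo (-1 : ℝ) 1
  · have h := sq_lt_one_iff_abs_lt_one x |>.2 (abs_lt.2 hx)
    rw [Set.indicator_of_mem hx, Set.indicator_of_mem hx, Complex.ofReal_cpow (by linarith)]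
    push_cast
    ring_nf
  · simp [Set.indicator_of_notMem hx]

/-- On the closed rectangle `Re (1 - z²) = 1 - x² + y² ≥ 0`, so the principal branch causes no jump.
At the corners `±1` the base is `0`; continuity there needs `ℓ > 0`, whereas for `ℓ = 0` the power
is constantly `1`. -/
theorem continuousOn_one_sub_sq_cpow_mul_exp (hℓ : 0 ≤ ℓ) (ω : ℝ) :
    ContinuousOn (fun z : ℂ => (1 - z ^ 2) ^ (ℓ : ℂ) * Complex.exp (Complex.I * ω * z))
      (Set.uIcc (-1 : ℝ) 1 ×ℂ Set.uIcc (0 : ℝ) 1) := by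
  refine ContinuousOn.mul ?_ (Continuous.continuousOn (by fun_prop))
  rcases hℓ.eq_or_lt with rfl | hpos
  · simpa using continuousOn_const
  intro z hz
  rw [Complex.mem_reProdIm, Set.uIcc_of_le (by norm_num), Set.uIcc_of_le (by norm_num)] at hz
  have hre : 0 ≤ (1 - z ^ 2).re := by
    have : (1 - z ^ 2).re = 1 - z.re ^ 2 + z.im ^ 2 := by
      simp [pow_two]
      ring
    rw [this]
    nlinarith [hz.1.1, hz.1.2, sq_nonneg z.im]
  have h1 : ContinuousAt (fun w : ℂ => w ^ (ℓ : ℂ)) (1 - z ^ 2) :=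
    Complex.continuousAt_cpow_const_of_re_pos (Or.inl hre) (by simpa using hpos)
  have h2 : ContinuousAt (fun z : ℂ => 1 - z ^ 2) z := by fun_prop
  exact (ContinuousAt.comp (f := fun z : ℂ => 1 - z ^ 2) h1 h2).continuousWithinAt

theorem differentiableOn_one_sub_sq_cpow_mul_exp (ℓ ω : ℝ) :
    DifferentiableOn ℂ (fun z : ℂ => (1 - z ^ 2) ^ (ℓ : ℂ) * Complex.exp (Complex.I * ω * z))
      (Set.Ioo (min (-1 : ℝ) 1) (max (-1) 1) ×ℂ Set.Ioo (min (0 : ℝ) 1) (max 0 1)) := by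
  intro z hz
  rw [Complex.mem_reProdIm, min_eq_left (by norm_num), max_eq_right (by norm_num)] at hz
  have hre : 0 < (1 - z ^ 2).re := by
    have : (1 - z ^ 2).re = 1 - z.re ^ 2 + z.im ^ 2 := by
      simp [pow_two]
      ring
    rw [this]
    nlinarith [hz.1.1, hz.1.2, sq_nonneg z.im]
  have h1 : DifferentiableAt ℂ (fun z : ℂ => (1 - z ^ 2) ^ (ℓ : ℂ)) z :=
    DifferentiableAt.cpow (by fun_prop) (differentiableAt_const _) (Or.inl hre)
  exact (h1.mul (by fun_prop)).differentiableWithinAt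

theorem norm_integral_top_le (hℓ : 0 ≤ ℓ) (ω : ℝ) :
    ‖∫ x : ℝ in (-1 : ℝ)..1, (1 - ((x : ℂ) + Complex.I) ^ 2) ^ (ℓ : ℂ) *
      Complex.exp (Complex.I * ω * (x + Complex.I))‖ ≤ 5 ^ ℓ * Real.exp (-ω) * 2 := by
  have h := intervalIntegral.norm_integral_le_of_norm_le_const (a := (-1 : ℝ)) (b := 1)
    (C := 5 ^ ℓ * Real.exp (-ω)) (f := fun x : ℝ => (1 - ((x : ℂ) + Complex.I) ^ 2) ^ (ℓ : ℂ) *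
      Complex.exp (Complex.I * ω * (x + Complex.I))) ?_
  · refine h.trans_eq ?_
    norm_num
  intro x hx
  rw [Set.uIoc_of_le (by norm_num)] at hx
  have hx1 : |x| ≤ 1 := abs_le.2 ⟨hx.1.le, hx.2⟩
  rw [norm_mul, Complex.norm_cpow_real, Complex.norm_exp]
  have e : (Complex.I * ω * (x + Complex.I)).re = -ω := by simp
  rw [e]
  gcongr
  calc ‖1 - ((x : ℂ) + Complex.I) ^ 2‖ ≤ ‖(1 : ℂ)‖ + ‖((x : ℂ) + Complex.I) ^ 2‖ := norm_sub_le _ _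
    _ ≤ 1 + 2 ^ 2 := by
        rw [norm_one, norm_pow]
        gcongr
        refine (norm_add_le _ _).trans ?_
        rw [Complex.norm_real, Complex.norm_I, Real.norm_eq_abs]
        linarith
    _ = 5 := by norm_num

/-- Near the endpoint `ε = ±1` one has `1 - (ε + iy)² = y² - 2εiy`, of modulus at most `3y`, while
the exponential has modulus `exp (-ω y)`. Extending the range to `(0, ∞)` gives a Gamma integral. -/
theorem norm_integral_side_le (hℓ : 0 ≤ ℓ) {ω : ℝ} (hω : 0 < ω) {ε : ℝ} (hε : ε = 1 ∨ ε = -1) :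
    ‖∫ y : ℝ in (0 : ℝ)..1, (1 - ((ε : ℂ) + y * Complex.I) ^ 2) ^ (ℓ : ℂ) *
      Complex.exp (Complex.I * ω * (ε + y * Complex.I))‖ ≤
      3 ^ ℓ * Real.Gamma (ℓ + 1) * ω ^ (-(ℓ + 1)) := by
  have hG := Real.integral_rpow_mul_exp_neg_mul_Ioi (a := ℓ + 1) (r := ω) (by linarith) hω
  have hI : IntegrableOn (fun t : ℝ => t ^ (ℓ + 1 - 1) * Real.exp (-(ω * t))) (Set.Ioi 0) := by
    -- A non-integrable function has integral `0` by convention, but the Gamma value is positive.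
    by_contra h
    rw [integral_undef h] at hG
    have := Real.Gamma_pos_of_pos (s := ℓ + 1) (by linarith)
    have : 0 < (1 / ω) ^ (ℓ + 1) * Real.Gamma (ℓ + 1) := by positivity
    linarith
  have hpt : ∀ y ∈ Set.Ioc (0 : ℝ) 1, ‖(1 - ((ε : ℂ) + y * Complex.I) ^ 2) ^ (ℓ : ℂ) *
      Complex.exp (Complex.I * ω * (ε + y * Complex.I))‖ ≤
      3 ^ ℓ * (y ^ (ℓ + 1 - 1) * Real.exp (-(ω * y))) := by
    intro y hy
    rw [norm_mul, Complex.norm_cpow_real, Complex.norm_exp]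
    have e : (Complex.I * ω * (ε + y * Complex.I)).re = -(ω * y) := by
      simp
    have hε2 : (ε : ℂ) ^ 2 = 1 := by
      rcases hε with rfl | rfl <;> simp
    have hεn : ‖(ε : ℂ)‖ = 1 := by
      rcases hε with rfl | rfl <;> simp
    have e2 : 1 - ((ε : ℂ) + y * Complex.I) ^ 2 = (y : ℂ) ^ 2 - 2 * ε * y * Complex.I := by
      have := Complex.I_sq
      linear_combination (-1 : ℂ) * hε2 - (y : ℂ) ^ 2 * this
    have hn : ‖1 - ((ε : ℂ) + y * Complex.I) ^ 2‖ ≤ 3 * y := by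
      rw [e2]
      refine (norm_sub_le _ _).trans ?_
      simp only [norm_pow, norm_mul, hεn, Complex.norm_real, Complex.norm_I, Complex.norm_ofNat,
        Real.norm_of_nonneg hy.1.le]
      nlinarith [hy.1, hy.2]
    rw [e, add_sub_cancel_right, ← mul_assoc, ← Real.mul_rpow (by norm_num) hy.1.le]
    gcongr
  rw [intervalIntegral.integral_of_le zero_le_one]
  calc _ ≤ ∫ y in Set.Ioc (0 : ℝ) 1, 3 ^ ℓ * (y ^ (ℓ + 1 - 1) * Real.exp (-(ω * y))) := by
        refine norm_integral_le_of_norm_le ?_ ((ae_restrict_iff' measurableSet_Ioc).2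
          (ae_of_all _ hpt))
        exact (hI.mono_set Set.Ioc_subset_Ioi_self).const_mul _
    _ ≤ ∫ y in Set.Ioi (0 : ℝ), 3 ^ ℓ * (y ^ (ℓ + 1 - 1) * Real.exp (-(ω * y))) := by
        refine setIntegral_mono_set (hI.const_mul _) ?_ Set.Ioc_subset_Ioi_self.eventuallyLE
        refine (ae_restrict_iff' measurableSet_Ioi).2 (ae_of_all _ fun y hy => ?_)
        have : (0 : ℝ) < y := hy
        positivity
    _ = _ := by
        rw [integral_const_mul, hG, one_div, Real.inv_rpow hω.le, Real.rpow_neg hω.le]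
        ring

/-- Cauchy's theorem on the rectangle `[-1, 1] × [0, 1]` replaces the real segment by the other
three sides: the vertical ones contribute order `ω^(-(ℓ+1))`, the top one order `exp (-ω)`. -/
theorem exists_norm_integral_le (hℓ : 0 ≤ ℓ) : ∃ C : ℝ, 0 ≤ C ∧ ∀ ω : ℝ, 0 < ω →
    ‖∫ x : ℝ in (-1 : ℝ)..1, (1 - (x : ℂ) ^ 2) ^ (ℓ : ℂ) * Complex.exp (Complex.I * ω * x)‖ ≤
      C * ω ^ (-(ℓ + 1)) := by
  have hGp := Real.Gamma_pos_of_pos (s := ℓ + 1) (by linarith)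
  refine ⟨5 ^ ℓ * (ℓ + 1) ^ (ℓ + 1) * 2 + 2 * (3 ^ ℓ * Real.Gamma (ℓ + 1)), by positivity,
    fun ω hω => ?_⟩
  have hrect := Complex.integral_boundary_rect_eq_zero_of_continuousOn_of_differentiableOn
    (fun z : ℂ => (1 - z ^ 2) ^ (ℓ : ℂ) * Complex.exp (Complex.I * ω * z)) (-1) (1 + Complex.I)
    (by simpa using continuousOn_one_sub_sq_cpow_mul_exp hℓ ω)
    (by simpa using differentiableOn_one_sub_sq_cpow_mul_exp ℓ ω)
  simp only [Complex.neg_re, Complex.one_re, Complex.add_re, Complex.I_re, add_zero,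
    Complex.neg_im, Complex.one_im, neg_zero, Complex.ofReal_zero, zero_mul, Complex.add_im,
    Complex.I_im, zero_add, Complex.ofReal_one, one_mul] at hrect
  have h1 := norm_integral_top_le hℓ ω
  have h2 := norm_integral_side_le hℓ hω (Or.inl rfl)
  have h3 := norm_integral_side_le hℓ hω (Or.inr rfl)
  -- From `x ≤ exp x` at `x = ω / (ℓ + 1)`, raised to the power `ℓ + 1`.
  have hexp : Real.exp (-ω) ≤ (ℓ + 1) ^ (ℓ + 1) * ω ^ (-(ℓ + 1)) := by
    have h4 : ω / (ℓ + 1) ≤ Real.exp (ω / (ℓ + 1)) :=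
      (by linarith [Real.add_one_le_exp (ω / (ℓ + 1))])
    have h5 : (ω / (ℓ + 1)) ^ (ℓ + 1) ≤ Real.exp ω := by
      refine (Real.rpow_le_rpow (by positivity) h4 (by linarith)).trans_eq ?_
      rw [← Real.exp_mul]
      congr 1
      field_simp
    rw [Real.div_rpow hω.le (by linarith), div_le_iff₀ (by positivity)] at h5
    rw [Real.exp_neg, Real.rpow_neg hω.le, ← div_eq_mul_inv, inv_eq_one_div,
      div_le_div_iff₀ (Real.exp_pos _) (by positivity)]
    linarith
  push_cast at h2 h3
  set A := ∫ x : ℝ in (-1 : ℝ)..1, (1 - (x : ℂ) ^ 2) ^ (ℓ : ℂ) * Complex.exp (Complex.I * ω * x)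
  set B := ∫ x : ℝ in (-1 : ℝ)..1, (1 - ((x : ℂ) + Complex.I) ^ 2) ^ (ℓ : ℂ) *
      Complex.exp (Complex.I * ω * (x + Complex.I))
  set D := ∫ y : ℝ in (0 : ℝ)..1, (1 - ((1 : ℂ) + y * Complex.I) ^ 2) ^ (ℓ : ℂ) *
      Complex.exp (Complex.I * ω * (1 + y * Complex.I))
  set E := ∫ y : ℝ in (0 : ℝ)..1, (1 - ((-1 : ℂ) + y * Complex.I) ^ 2) ^ (ℓ : ℂ) *
      Complex.exp (Complex.I * ω * (-1 + y * Complex.I))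
  have hA : A = B - Complex.I * D + Complex.I * E := by
    simp only [smul_eq_mul, Complex.ofReal_neg, Complex.ofReal_one] at hrect
    linear_combination hrect
  have hn : ‖A‖ ≤ ‖B‖ + ‖D‖ + ‖E‖ := by
    rw [hA]
    refine (norm_add_le _ _).trans ?_
    have := norm_sub_le B (Complex.I * D)
    simp only [norm_mul, Complex.norm_I, one_mul] at this ⊢
    linarith
  have h5 : (5 : ℝ) ^ ℓ * Real.exp (-ω) * 2 ≤
      5 ^ ℓ * ((ℓ + 1) ^ (ℓ + 1) * ω ^ (-(ℓ + 1))) * 2 := by gcongr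
  linarith

theorem exists_truncPowHat_sq_le (hℓ : 0 ≤ ℓ) : ∃ C : ℝ, ∀ t : ℝ,
    truncPowHat ℓ t ^ 2 ≤ C * (1 + (2 * Real.pi * t) ^ 2) ^ (-(ℓ + 1)) := by
  obtain ⟨C, hC0, hC⟩ := exists_norm_integral_le hℓ
  have hpos : ∀ ω : ℝ, 0 < ω → |∫ x, truncPow ℓ x * Real.cos (ω * x)| ≤ C * ω ^ (-(ℓ + 1)) := by
    intro ω hω
    have := hC ω hω
    rwa [← integral_truncPow_mul_exp_eq_intervalIntegral, integral_truncPow_mul_exp hℓ,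
      Complex.norm_real, Real.norm_eq_abs] at this
  -- For `u² ≤ 1` the trivial bound `2` is squared to `4`; for `u² > 1` the contour bound applies
  -- with `u² ≥ (1 + u²) / 2`. The factor `2^(ℓ+1)` pays for comparing with `1 + u²` in both cases.
  refine ⟨2 ^ (ℓ + 1) * (4 + C ^ 2), fun t => ?_⟩
  set u := 2 * Real.pi * t with hu
  have h2 : (2 : ℝ) ^ (ℓ + 1) * 2 ^ (-(ℓ + 1)) = 1 := by
    rw [← Real.rpow_add two_pos]
    simp
  have hu0 : 0 < 1 + u ^ 2 := by positivity
  rcases le_or_gt (u ^ 2) 1 with h | h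
  · have h3 : (2 : ℝ) ^ (-(ℓ + 1)) ≤ (1 + u ^ 2) ^ (-(ℓ + 1)) :=
      Real.rpow_le_rpow_of_nonpos hu0 (by linarith) (by linarith)
    have h4 : truncPowHat ℓ t ^ 2 ≤ 4 := by
      have := abs_le.1 (abs_truncPowHat_le_two hℓ t)
      nlinarith
    calc truncPowHat ℓ t ^ 2 ≤ 4 := h4
      _ ≤ 4 + C ^ 2 := by nlinarith
      _ = 2 ^ (ℓ + 1) * (4 + C ^ 2) * 2 ^ (-(ℓ + 1)) := by
          rw [mul_right_comm, h2, one_mul]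
      _ ≤ _ := by gcongr
  · have hu1 : 0 < |u| := by
      rw [abs_pos]
      rintro h0
      rw [h0] at h
      norm_num at h
    have h3 : |truncPowHat ℓ t| ≤ C * |u| ^ (-(ℓ + 1)) := by
      refine le_trans (le_of_eq ?_) (hpos |u| hu1)
      rw [truncPowHat]
      congr 2
      ext x
      rw [← Real.cos_abs (2 * Real.pi * t * x), ← Real.cos_abs (|u| * x)]
      simp only [abs_mul, abs_abs, hu]
    have h4 : truncPowHat ℓ t ^ 2 ≤ C ^ 2 * (u ^ 2) ^ (-(ℓ + 1)) := by
      rw [← sq_abs, ← sq_abs u]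
      refine (pow_le_pow_left₀ (abs_nonneg _) h3 2).trans_eq ?_
      rw [mul_pow, ← Real.rpow_natCast, ← Real.rpow_natCast, ← Real.rpow_natCast,
        ← Real.rpow_mul hu1.le, ← Real.rpow_mul hu1.le, mul_comm (-(ℓ + 1))]
    have h5 : (u ^ 2) ^ (-(ℓ + 1)) ≤ ((1 + u ^ 2) / 2) ^ (-(ℓ + 1)) :=
      Real.rpow_le_rpow_of_nonpos (by positivity) (by linarith) (by linarith)
    have h6 : ((1 + u ^ 2) / 2) ^ (-(ℓ + 1)) = 2 ^ (ℓ + 1) * (1 + u ^ 2) ^ (-(ℓ + 1)) := by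
      rw [Real.div_rpow hu0.le two_pos.le, Real.rpow_neg two_pos.le, div_inv_eq_mul, mul_comm]
    calc truncPowHat ℓ t ^ 2 ≤ C ^ 2 * (u ^ 2) ^ (-(ℓ + 1)) := h4
      _ ≤ (4 + C ^ 2) * (2 ^ (ℓ + 1) * (1 + u ^ 2) ^ (-(ℓ + 1))) := by
          rw [← h6]
          gcongr
          linarith
      _ = _ := by ring

/-- The integrand is `O((1 + t²)^(n/2 - ℓ - 1))`, with exponent at most `-1`. With `n = 2k` this is
where `k ≤ ℓ` enters. -/
theorem integrable_pow_mul_truncPowHat_sq (hℓ : 0 ≤ ℓ) {n : ℕ} (hn : (n : ℝ) ≤ 2 * ℓ) :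
    Integrable fun t => t ^ n * truncPowHat ℓ t ^ 2 := by
  obtain ⟨C, hC⟩ := exists_truncPowHat_sq_le hℓ
  have h1 : Integrable fun t : ℝ => C * (1 + ‖t‖ ^ 2) ^ (-(2 : ℝ) / 2) :=
    (integrable_rpow_neg_one_add_norm_sq (by simp)).const_mul C
  have hc := continuous_truncPowHat hℓ
  refine h1.mono' (Continuous.aestronglyMeasurable (by fun_prop)) (ae_of_all _ fun t => ?_)
  have hC0 : 0 ≤ C := by
    have := (sq_nonneg (truncPowHat ℓ 0)).trans (hC 0)
    simpa using this
  have ht : 0 < 1 + t ^ 2 := by positivity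
  have hpi := Real.pi_gt_three
  rw [norm_mul, norm_pow, Real.norm_eq_abs, Real.norm_of_nonneg (sq_nonneg _)]
  have e1 : (1 + (2 * Real.pi * t) ^ 2) ^ (-(ℓ + 1)) ≤ (1 + t ^ 2) ^ (-(ℓ + 1)) := by
    refine Real.rpow_le_rpow_of_nonpos ht ?_ (by linarith)
    have : t ^ 2 * 1 ≤ t ^ 2 * (2 * Real.pi) ^ 2 := by
      refine mul_le_mul_of_nonneg_left ?_ (sq_nonneg t)
      nlinarith
    nlinarith
  have e2 : |t| ^ n ≤ (1 + t ^ 2) ^ ((n : ℝ) / 2) := by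
    have h3 : |t| ≤ (1 + t ^ 2) ^ (1 / 2 : ℝ) := by
      rw [← Real.sqrt_eq_rpow]
      exact Real.abs_le_sqrt (by linarith)
    refine (pow_le_pow_left₀ (abs_nonneg t) h3 n).trans_eq ?_
    rw [← Real.rpow_natCast, ← Real.rpow_mul ht.le]
    congr 1
    ring
  calc |t| ^ n * truncPowHat ℓ t ^ 2
      ≤ (1 + t ^ 2) ^ ((n : ℝ) / 2) * (C * (1 + t ^ 2) ^ (-(ℓ + 1))) := by
        refine mul_le_mul e2 ((hC t).trans ?_) (sq_nonneg _) (by positivity)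
        gcongr
    _ = C * (1 + t ^ 2) ^ ((n : ℝ) / 2 + -(ℓ + 1)) := by
        rw [Real.rpow_add ht]
        ring
    _ ≤ C * (1 + t ^ 2) ^ (-(2 : ℝ) / 2) := by
        gcongr
        · nlinarith [sq_nonneg t]
        · linarith
    _ = _ := by rw [sq_abs]

open scoped Convolution in
-- For `ℓ = 0` the factor jumps at `±1`; dominated convergence only needs continuity at `r` for `t ≠
-- r ± 1`.
theorem continuous_convolution_truncPow (hℓ : 0 ≤ ℓ) :
    Continuous (convolution (fun x => (truncPow ℓ x : ℂ)) (fun x => (truncPow ℓ x : ℂ))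
      (ContinuousLinearMap.mul ℂ ℂ) volume) := by
  refine continuous_iff_continuousAt.2 fun r => ?_
  refine continuousAt_of_dominated (bound := truncPow ℓ) (Eventually.of_forall fun x => ?_)
    (Eventually.of_forall fun x => ae_of_all _ fun t => ?_) (integrable_truncPow hℓ) ?_
  · have h := Complex.measurable_ofReal.comp (measurable_truncPow ℓ)
    exact (h.mul (h.comp (measurable_const.sub measurable_id))).aestronglyMeasurable
  · simp only [ContinuousLinearMap.mul_apply', norm_mul, Complex.norm_real,
      Real.norm_of_nonneg (truncPow_nonneg _ _)]
    exact mul_le_of_le_one_right (truncPow_nonneg _ _) (truncPow_le_one hℓ _)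
  · have h1 : ∀ᵐ t : ℝ, t ≠ r - 1 := by simp [ae_iff]
    have h2 : ∀ᵐ t : ℝ, t ≠ r + 1 := by simp [ae_iff]
    filter_upwards [h1, h2] with t ht1 ht2
    have h3 : ContinuousAt (truncPow ℓ) (r - t) :=
      continuousAt_truncPow ℓ (fun h => ht1 (by linarith)) (fun h => ht2 (by linarith))
    have h4 : ContinuousAt (fun x => truncPow ℓ (x - t)) r :=
      ContinuousAt.comp (f := fun x => x - t) h3 (by fun_prop)
    simp only [ContinuousLinearMap.mul_apply']
    exact continuousAt_const.mul (Complex.continuous_ofReal.continuousAt.comp h4)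

theorem convolution_truncPow_eq (hℓ : 0 ≤ ℓ) (r : ℝ) :
    convolution (truncPow ℓ) (truncPow ℓ) (ContinuousLinearMap.mul ℝ ℝ) volume r =
      ∫ t, truncPowHat ℓ t ^ 2 * Real.cos (2 * Real.pi * t * r) := by
  set fc : ℝ → ℂ := fun x => (truncPow ℓ x : ℂ) with hfc
  have hfi : Integrable fc := (integrable_truncPow hℓ).ofReal
  have hc : ((convolution (truncPow ℓ) (truncPow ℓ) (ContinuousLinearMap.mul ℝ ℝ) volume r : ℝ) : ℂ)
      = convolution fc fc (ContinuousLinearMap.mul ℂ ℂ) volume r := by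
    simp only [convolution, hfc, ContinuousLinearMap.mul_apply', ← Complex.ofReal_mul,
      integral_complex_ofReal]
  have hF : 𝓕 (convolution fc fc (ContinuousLinearMap.mul ℂ ℂ) volume) =
      fun t => ((truncPowHat ℓ t ^ 2 : ℝ) : ℂ) := by
    ext t
    rw [Real.fourier_mul_convolution_eq hfi hfi, hfc, fourier_truncPow hℓ]
    push_cast
    ring
  have hg : Integrable fun t => truncPowHat ℓ t ^ 2 := by
    simpa using integrable_pow_mul_truncPowHat_sq hℓ (n := 0) (by simpa using hℓ)
  have hinv := (continuous_convolution_truncPow hℓ).fourierInv_fourier_eq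
    (hfi.integrable_convolution (ContinuousLinearMap.mul ℂ ℂ) hfi) (by rw [hF]; exact hg.ofReal)
  have h := congrFun hinv r
  rw [hF, ← hc, Real.fourierInv_eq'] at h
  have h2 := congrArg Complex.re h
  rw [Complex.ofReal_re] at h2
  rw [← h2]
  rw [← RCLike.re_eq_complex_re, ← integral_re]
  · refine integral_congr_ae (ae_of_all _ fun t => ?_)
    simp only [RCLike.re_eq_complex_re, smul_eq_mul, Complex.re_mul_ofReal]
    rw [Complex.exp_ofReal_mul_I_re, mul_comm]
    congr 2
    simp
    ring
  · refine hg.ofReal.bdd_mul (c := 1) (Continuous.aestronglyMeasurable (by fun_prop))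
      (ae_of_all _ fun t => ?_)
    rw [Complex.norm_exp_ofReal_mul_I]

end TruncPowDecay

/-! ### The operator `𝒟` raises the dimension of a radial transform by two. -/

section DimensionWalk

/-- Up to normalization, `walkKernel j ‖x‖` is the Fourier transform of the surface measure of the
unit sphere of `ℝ ^ (2 j + 1)`. -/
noncomputable def walkKernel : ℕ → ℝ → ℝ
  | 0 => Real.cos
  | j + 1 => fun u => ∫ θ in (0 : ℝ)..Real.pi, Real.cos (u * Real.cos θ) * Real.sin θ ^ (2 * j + 1)

/-- The constants in `(walkKernel j)' u = -walkConst j * u * walkKernel (j + 1) u`. -/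
noncomputable def walkConst : ℕ → ℝ
  | 0 => 1 / 2
  | j + 1 => 1 / (2 * j + 2)

theorem walkConst_pos (j : ℕ) : 0 < walkConst j := by
  cases j <;> simp only [walkConst] <;> positivity

theorem abs_walkKernel_le (j : ℕ) (u : ℝ) : |walkKernel j u| ≤ Real.pi := by
  cases j with
  | zero => exact (Real.abs_cos_le_one u).trans (by linarith [Real.pi_gt_three])
  | succ j =>
    have h := intervalIntegral.norm_integral_le_of_norm_le_const (a := 0) (b := Real.pi) (C := 1)
      (f := fun θ => Real.cos (u * Real.cos θ) * Real.sin θ ^ (2 * j + 1)) fun θ _ => by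
        rw [norm_mul, norm_pow]
        exact mul_le_one₀ (Real.abs_cos_le_one _) (by positivity)
          (pow_le_one₀ (norm_nonneg _) (Real.abs_sin_le_one _))
    simpa [walkKernel, abs_of_pos Real.pi_pos] using h

theorem hasDerivAt_walkKernel (j : ℕ) (u : ℝ) :
    HasDerivAt (walkKernel j) (-(walkConst j * u * walkKernel (j + 1) u)) u := by
  cases j with
  | zero =>
    have hd : ∀ θ ∈ Set.uIcc 0 Real.pi, HasDerivAt (fun θ => -Real.sin (u * Real.cos θ))
        (u * (Real.cos (u * Real.cos θ) * Real.sin θ ^ (2 * 0 + 1))) θ := fun θ _ => by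
      convert! (((Real.hasDerivAt_cos θ).const_mul u).sin).neg using 1
      ring
    have h := intervalIntegral.integral_eq_sub_of_hasDerivAt hd
      (Continuous.intervalIntegrable (by fun_prop) _ _)
    rw [intervalIntegral.integral_const_mul] at h
    -- The factor `2` here is the reason for `walkConst 0 = 1 / 2`.
    have h2 : u * walkKernel 1 u = 2 * Real.sin u := by
      rw [walkKernel, h]
      simp
      ring
    have h3 : -(walkConst 0 * u * walkKernel (0 + 1) u) = -Real.sin u := by
      simp only [walkConst, zero_add]
      linear_combination (-1 / 2) * h2
    rw [h3]
    exact Real.hasDerivAt_cos u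
  | succ j =>
    have hdiff := (intervalIntegral.hasDerivAt_integral_of_dominated_loc_of_deriv_le
      (μ := volume) (a := 0) (b := Real.pi) (x₀ := u) (s := Set.univ) (bound := fun _ => 1)
      (F := fun u θ => Real.cos (u * Real.cos θ) * Real.sin θ ^ (2 * j + 1))
      (F' := fun u θ => -Real.sin (u * Real.cos θ) * Real.cos θ * Real.sin θ ^ (2 * j + 1))
      univ_mem
      (Eventually.of_forall fun u => Continuous.aestronglyMeasurable (by fun_prop))
      (Continuous.intervalIntegrable (by fun_prop) _ _)
      (Continuous.aestronglyMeasurable (by fun_prop))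
      (ae_of_all _ fun θ _ v _ => by
        rw [norm_mul, norm_mul, norm_neg, norm_pow]
        exact mul_le_one₀ (mul_le_one₀ (Real.abs_sin_le_one _) (norm_nonneg _)
          (Real.abs_cos_le_one _)) (by positivity)
          (pow_le_one₀ (norm_nonneg _) (Real.abs_sin_le_one _)))
      intervalIntegrable_const
      (ae_of_all _ fun θ _ v _ => by
        have h1 : HasDerivAt (fun v : ℝ => v * Real.cos θ) (Real.cos θ) v := by
          simpa using (hasDerivAt_id v).mul_const (Real.cos θ)
        exact h1.cos.mul_const _)).2
    -- Integration by parts in `θ`: this primitive vanishes at `0` and `π`, which trades `sin (u cos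
    -- θ) cos θ` for `u cos (u cos θ) sin² θ`.
    have hd : ∀ θ ∈ Set.uIcc 0 Real.pi, HasDerivAt
        (fun θ => Real.sin (u * Real.cos θ) * Real.sin θ ^ (2 * j + 2))
        (-u * (Real.cos (u * Real.cos θ) * Real.sin θ ^ (2 * (j + 1) + 1)) - (2 * j + 2) *
          (-Real.sin (u * Real.cos θ) * Real.cos θ * Real.sin θ ^ (2 * j + 1))) θ := fun θ _ => by
      convert! (((Real.hasDerivAt_cos θ).const_mul u).sin).mul
        ((Real.hasDerivAt_sin θ).pow (2 * j + 2)) using 1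
      have e : 2 * j + 2 - 1 = 2 * j + 1 := by omega
      rw [e, Pi.pow_apply]
      push_cast
      ring
    have h := intervalIntegral.integral_eq_sub_of_hasDerivAt hd
      (Continuous.intervalIntegrable (by fun_prop) _ _)
    rw [intervalIntegral.integral_sub (Continuous.intervalIntegrable (by fun_prop) _ _)
      (Continuous.intervalIntegrable (by fun_prop) _ _), intervalIntegral.integral_const_mul,
      intervalIntegral.integral_const_mul] at h
    have e : -(walkConst (j + 1) * u * walkKernel (j + 1 + 1) u) = ∫ θ in (0 : ℝ)..Real.pi,
        -Real.sin (u * Real.cos θ) * Real.cos θ * Real.sin θ ^ (2 * j + 1) := by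
      simp only [Real.sin_pi, Real.sin_zero] at h
      rw [zero_pow (by omega), mul_zero, mul_zero, sub_zero] at h
      have h2 : (0 : ℝ) < 2 * j + 2 := by positivity
      simp only [walkConst, walkKernel]
      generalize (∫ θ in (0 : ℝ)..Real.pi, -Real.sin (u * Real.cos θ) * Real.cos θ *
        Real.sin θ ^ (2 * j + 1)) = I₁ at h ⊢
      generalize (∫ θ in (0 : ℝ)..Real.pi, Real.cos (u * Real.cos θ) *
        Real.sin θ ^ (2 * (j + 1) + 1)) = I₂ at h ⊢
      field_simp
      linarith
    rw [e]
    exact hdiff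

theorem continuous_walkKernel (j : ℕ) : Continuous (walkKernel j) :=
  continuous_iff_continuousAt.2 fun u => (hasDerivAt_walkKernel j u).continuousAt

/-- The radial Fourier transform in dimension `2 j + 1`, up to normalization. -/
noncomputable def radialTransform (g : ℝ → ℝ) (j : ℕ) (r : ℝ) : ℝ :=
  ∫ t in Set.Ioi (0 : ℝ), t ^ (2 * j) * g t * walkKernel j (2 * Real.pi * t * r)

variable {g : ℝ → ℝ} (hg : Continuous g)
include hg

theorem continuous_radialTransform {j : ℕ}
    (hj : IntegrableOn (fun t => t ^ (2 * j) * g t) (Set.Ioi 0)) :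
    Continuous (radialTransform g j) := by
  have hw := continuous_walkKernel j
  refine continuous_of_dominated (bound := fun t => ‖t ^ (2 * j) * g t‖ * Real.pi)
    (fun r => Continuous.aestronglyMeasurable (by fun_prop))
    (fun r => ae_of_all _ fun t => ?_) (hj.norm.mul_const _)
    (ae_of_all _ fun t => by fun_prop)
  rw [norm_mul]
  gcongr
  exact abs_walkKernel_le _ _

/-- The chain rule gives one factor `2πt` and the derivative of `walkKernel` another, `2πtr`; the
resulting `t²` raises `t^(2j)` to `t^(2(j+1))`. -/
theorem hasDerivAt_radialTransform {j : ℕ}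
    (hj : IntegrableOn (fun t => t ^ (2 * j) * g t) (Set.Ioi 0))
    (hj' : IntegrableOn (fun t => t ^ (2 * (j + 1)) * g t) (Set.Ioi 0)) (r : ℝ) :
    HasDerivAt (radialTransform g j)
      (-((2 * Real.pi) ^ 2 * walkConst j * r * radialTransform g (j + 1) r)) r := by
  have hw := continuous_walkKernel j
  have hw' := continuous_walkKernel (j + 1)
  have h := (hasDerivAt_integral_of_dominated_loc_of_deriv_le
    (μ := volume.restrict (Set.Ioi (0 : ℝ))) (x₀ := r) (s := Metric.ball r 1)
    (F := fun r t => t ^ (2 * j) * g t * walkKernel j (2 * Real.pi * t * r))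
    (F' := fun r t => -((2 * Real.pi) ^ 2 * walkConst j * r) *
      (t ^ (2 * (j + 1)) * g t * walkKernel (j + 1) (2 * Real.pi * t * r)))
    (bound := fun t => (2 * Real.pi) ^ 2 * walkConst j * (|r| + 1) *
      (‖t ^ (2 * (j + 1)) * g t‖ * Real.pi))
    (Metric.ball_mem_nhds r one_pos)
    (Eventually.of_forall fun r => Continuous.aestronglyMeasurable (by fun_prop)) ?_
    (Continuous.aestronglyMeasurable (by fun_prop)) (ae_of_all _ fun t x hx => ?_)
    ((hj'.norm.mul_const _).const_mul _) (ae_of_all _ fun t x _ => ?_)).2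
  · rw [integral_const_mul] at h
    rw [← neg_mul]
    exact h
  · refine (hj.norm.mul_const Real.pi).mono' (Continuous.aestronglyMeasurable (by fun_prop))
      (ae_of_all _ fun t => ?_)
    rw [norm_mul]
    gcongr
    exact abs_walkKernel_le _ _
  · have hx' : |x| ≤ |r| + 1 := by
      have h1 : |x - r| < 1 := by simpa [Real.dist_eq] using hx
      have h2 := abs_sub_abs_le_abs_sub x r
      linarith
    have hc := walkConst_pos j
    rw [norm_mul, norm_neg, norm_mul, norm_mul (t ^ (2 * (j + 1)) * g t),
      Real.norm_of_nonneg (by positivity), Real.norm_eq_abs x]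
    gcongr
    exact abs_walkKernel_le _ _
  · have h1 : HasDerivAt (fun x : ℝ => 2 * Real.pi * t * x) (2 * Real.pi * t) x := by
      simpa using (hasDerivAt_id x).const_mul (2 * Real.pi * t)
    convert! ((hasDerivAt_walkKernel j (2 * Real.pi * t * x)).comp x h1).const_mul
      (t ^ (2 * j) * g t) using 1
    ring

theorem dimWalk_const_mul_radialTransform {j : ℕ}
    (hj : IntegrableOn (fun t => t ^ (2 * j) * g t) (Set.Ioi 0))
    (hj' : IntegrableOn (fun t => t ^ (2 * (j + 1)) * g t) (Set.Ioi 0)) (c : ℝ) :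
    dimWalk (fun r => c * radialTransform g j r) =
      fun r => c * ((2 * Real.pi) ^ 2 * walkConst j) * radialTransform g (j + 1) r := by
  have hne : ∀ r : ℝ, r ≠ 0 → -deriv (fun r => c * radialTransform g j r) r / r =
      c * ((2 * Real.pi) ^ 2 * walkConst j) * radialTransform g (j + 1) r := fun r hr => by
    rw [((hasDerivAt_radialTransform hg hj hj' r).const_mul c).deriv]
    field_simp
  ext r
  rw [dimWalk]
  split_ifs with h
  · subst h
    refine Tendsto.limUnder_eq ?_
    have hlim : Tendsto (fun r => c * ((2 * Real.pi) ^ 2 * walkConst j) *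
        radialTransform g (j + 1) r) (𝓝[>] 0)
        (𝓝 (c * ((2 * Real.pi) ^ 2 * walkConst j) * radialTransform g (j + 1) 0)) :=
      (((continuous_radialTransform hg hj').tendsto 0).const_mul _).mono_left nhdsWithin_le_nhds
    refine hlim.congr' ?_
    filter_upwards [self_mem_nhdsWithin] with t ht
    exact (hne t (ne_of_gt ht)).symm
  · exact hne r h

theorem exists_dimWalk_iterate_eq {k : ℕ}
    (hk : ∀ j ≤ k, IntegrableOn (fun t => t ^ (2 * j) * g t) (Set.Ioi 0)) {c : ℝ} (hc : 0 < c) :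
    ∃ c' : ℝ, 0 < c' ∧ dimWalk^[k] (fun r => c * radialTransform g 0 r) =
      fun r => c' * radialTransform g k r := by
  induction k with
  | zero => exact ⟨c, hc, rfl⟩
  | succ k ih =>
    obtain ⟨c', hc', h⟩ := ih fun j hj => hk j (by omega)
    refine ⟨c' * ((2 * Real.pi) ^ 2 * walkConst k), ?_, ?_⟩
    · have := walkConst_pos k
      positivity
    · rw [Function.iterate_succ_apply', h]
      exact dimWalk_const_mul_radialTransform hg (hk k (by omega)) (hk (k + 1) le_rfl) c'

end DimensionWalk

/-! ### Fourier integrals of radial functions in odd dimension. -/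

section RadialFourier

/-- Splitting off the direction of `x`, the Fourier integral of a radial function is an integral
over `ℝ × ℝ ^ n`. -/
theorem exists_measurePreserving_radial {n : ℕ} (x : EuclideanSpace ℝ (Fin (n + 1))) :
    ∃ T : ℝ × EuclideanSpace ℝ (Fin n) → EuclideanSpace ℝ (Fin (n + 1)),
      MeasurableEmbedding T ∧ MeasurePreserving T ∧ ∀ p, ‖T p‖ = √(p.1 ^ 2 + ‖p.2‖ ^ 2) ∧
        inner ℝ x (T p) = ‖x‖ * p.1 := by
  have hdim : Module.finrank ℝ (WithLp 2 (ℝ × EuclideanSpace ℝ (Fin n))) = n + 1 := by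
    rw [(WithLp.linearEquiv 2 ℝ (ℝ × EuclideanSpace ℝ (Fin n))).finrank_eq]
    simp [add_comm]
  let L₀ : WithLp 2 (ℝ × EuclideanSpace ℝ (Fin n)) ≃ₗᵢ[ℝ] EuclideanSpace ℝ (Fin (n + 1)) :=
    ((stdOrthonormalBasis ℝ _).reindex (finCongr hdim)).repr
  set e : WithLp 2 (ℝ × EuclideanSpace ℝ (Fin n)) := WithLp.toLp 2 (‖x‖, 0) with he
  have hen : ‖L₀ e‖ = ‖x‖ := by
    rw [L₀.norm_map, he, WithLp.prod_norm_eq_of_L2]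
    simp
  -- Vectors of equal norm are exchanged by the reflection in their bisecting hyperplane; this
  -- aligns the first coordinate axis with `x`.
  let R := Submodule.reflection (Submodule.span ℝ {L₀ e - x})ᗮ
  have hR : R (L₀ e) = x := Submodule.reflection_sub hen
  let L := L₀.trans R
  have hL : L e = x := hR
  refine ⟨fun p => L (WithLp.toLp 2 p), ?_, ?_, fun p => ⟨?_, ?_⟩⟩
  · exact L.toHomeomorph.measurableEmbedding.comp
      (MeasurableEquiv.toLp 2 (ℝ × EuclideanSpace ℝ (Fin n))).measurableEmbedding
  · exact L.measurePreserving.comp (WithLp.volume_preserving_toLp ℝ (EuclideanSpace ℝ (Fin n)))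
  · rw [L.norm_map, WithLp.prod_norm_eq_of_L2]
    simp
  · conv_lhs => rw [← hL]
    rw [L.inner_map_map, he, WithLp.prod_inner_apply]
    simp [mul_comm]

variable {g : ℝ → ℝ} (hg : Continuous g)
include hg

/-- Polar coordinates `(v cos θ, v sin θ)`: the half plane is `0 < θ < π`, and the Jacobian `v`
times `(v sin θ)^(2k+1)` is `v^(2(k+1)) sin^(2k+1) θ`, the weight in `walkKernel`. -/
theorem integral_half_plane_eq_radialTransform {k : ℕ}
    (hk : IntegrableOn (fun t => t ^ (2 * (k + 1)) * g t) (Set.Ioi 0)) (r : ℝ) :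
    ∫ p : ℝ × ℝ, (Set.Ioi (0 : ℝ)).indicator (fun ρ => ρ ^ (2 * k + 1) *
      (g √(p.1 ^ 2 + ρ ^ 2) * Real.cos (2 * Real.pi * (r * p.1)))) p.2 =
      radialTransform g (k + 1) r := by
  rw [← integral_comp_polarCoord_symm, polarCoord_target]
  have hpt : ∀ p ∈ Set.Ioi (0 : ℝ) ×ˢ Set.Ioo (-Real.pi) Real.pi,
      p.1 • (Set.Ioi (0 : ℝ)).indicator (fun ρ => ρ ^ (2 * k + 1) *
        (g √((polarCoord.symm p).1 ^ 2 + ρ ^ 2) *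
          Real.cos (2 * Real.pi * (r * (polarCoord.symm p).1)))) (polarCoord.symm p).2 =
      (p.1 ^ (2 * (k + 1)) * g p.1) * (Set.Ioi (0 : ℝ)).indicator (fun θ =>
        Real.cos (2 * Real.pi * p.1 * r * Real.cos θ) * Real.sin θ ^ (2 * k + 1)) p.2 := by
    rintro ⟨v, θ⟩ ⟨hv, hθ⟩
    simp only [Set.mem_Ioi, Set.mem_Ioo] at hv hθ
    rw [polarCoord_symm_apply]
    by_cases h : 0 < θ
    · have hs := Real.sin_pos_of_pos_of_lt_pi h hθ.2
      rw [Set.indicator_of_mem (show v * Real.sin θ ∈ Set.Ioi 0 from mul_pos hv hs),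
        Set.indicator_of_mem (show θ ∈ Set.Ioi 0 from h)]
      have hsq : (v * Real.cos θ) ^ 2 + (v * Real.sin θ) ^ 2 = v ^ 2 := by
        linear_combination v ^ 2 * Real.sin_sq_add_cos_sq θ
      simp only [hsq, Real.sqrt_sq hv.le, smul_eq_mul]
      have : 2 * Real.pi * (r * (v * Real.cos θ)) = 2 * Real.pi * v * r * Real.cos θ := by ring
      rw [this]
      ring
    · have hs : Real.sin θ ≤ 0 := Real.sin_nonpos_of_nonpos_of_neg_pi_le (not_lt.1 h) hθ.1.le
      rw [Set.indicator_of_notMem (show v * Real.sin θ ∉ Set.Ioi 0 from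
          not_lt.2 (mul_nonpos_of_nonneg_of_nonpos hv.le hs)),
        Set.indicator_of_notMem (show θ ∉ Set.Ioi 0 from h)]
      simp
  rw [setIntegral_congr_fun (measurableSet_Ioi.prod measurableSet_Ioo) hpt]
  have hint : IntegrableOn (fun p : ℝ × ℝ => (p.1 ^ (2 * (k + 1)) * g p.1) *
      (Set.Ioi (0 : ℝ)).indicator (fun θ =>
        Real.cos (2 * Real.pi * p.1 * r * Real.cos θ) * Real.sin θ ^ (2 * k + 1)) p.2)
      (Set.Ioi (0 : ℝ) ×ˢ Set.Ioo (-Real.pi) Real.pi) (volume.prod volume) := by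
    have h1 : IntegrableOn (fun p : ℝ × ℝ => (p.1 ^ (2 * (k + 1)) * g p.1) * (1 : ℝ))
        (Set.Ioi (0 : ℝ) ×ˢ Set.Ioo (-Real.pi) Real.pi) (volume.prod volume) := by
      rw [IntegrableOn, ← Measure.prod_restrict]
      exact hk.mul_prod (g := fun _ => (1 : ℝ)) (integrableOn_const (by simp))
    refine Integrable.mono h1 ?_ (ae_of_all _ fun p => ?_)
    · refine Measurable.aestronglyMeasurable ?_
      refine Measurable.mul (by fun_prop) ?_
      have : (fun p : ℝ × ℝ => (Set.Ioi (0 : ℝ)).indicator (fun θ =>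
          Real.cos (2 * Real.pi * p.1 * r * Real.cos θ) * Real.sin θ ^ (2 * k + 1)) p.2) =
          (Prod.snd ⁻¹' Set.Ioi (0 : ℝ)).indicator (fun p : ℝ × ℝ =>
            Real.cos (2 * Real.pi * p.1 * r * Real.cos p.2) * Real.sin p.2 ^ (2 * k + 1)) := by
        ext p
        simp [Set.indicator]
      rw [this]
      exact Measurable.indicator (by fun_prop) (measurable_snd measurableSet_Ioi)
    · rw [norm_mul (p.1 ^ (2 * (k + 1)) * g p.1), norm_mul (p.1 ^ (2 * (k + 1)) * g p.1)]
      refine mul_le_mul_of_nonneg_left ?_ (norm_nonneg (p.1 ^ (2 * (k + 1)) * g p.1))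
      refine (norm_indicator_le_norm_self (fun θ : ℝ =>
        Real.cos (2 * Real.pi * p.1 * r * Real.cos θ) * Real.sin θ ^ (2 * k + 1)) p.2).trans ?_
      rw [norm_mul, norm_pow, norm_one]
      exact mul_le_one₀ (Real.abs_cos_le_one _) (by positivity)
        (pow_le_one₀ (norm_nonneg _) (Real.abs_sin_le_one _))
  rw [Measure.volume_eq_prod, setIntegral_prod _ hint, radialTransform]
  refine setIntegral_congr_fun measurableSet_Ioi fun v _ => ?_
  simp only
  rw [integral_const_mul, walkKernel]
  simp only
  rw [setIntegral_indicator measurableSet_Ioi,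
    intervalIntegral.integral_of_le Real.pi_pos.le, integral_Ioc_eq_integral_Ioo]
  congr 3
  ext θ
  simp only [Set.mem_inter_iff, Set.mem_Ioo, Set.mem_Ioi]
  have := Real.pi_pos
  constructor
  · rintro ⟨h1, h2⟩
    exact ⟨h2, h1.2⟩
  · rintro ⟨h1, h2⟩
    exact ⟨⟨by linarith, h2⟩, h1⟩

omit hg in
theorem integral_radial_mul_cos_eq_integral_integral {n : ℕ}
    (hgi : Integrable fun ω : EuclideanSpace ℝ (Fin (n + 1)) => g ‖ω‖)
    (x : EuclideanSpace ℝ (Fin (n + 1))) :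
    Integrable (fun p : ℝ × EuclideanSpace ℝ (Fin n) => g √(p.1 ^ 2 + ‖p.2‖ ^ 2))
      (volume.prod volume) ∧
    ∫ ω, g ‖ω‖ * Real.cos (2 * Real.pi * inner ℝ x ω) =
      ∫ τ : ℝ, ∫ η : EuclideanSpace ℝ (Fin n),
        g √(τ ^ 2 + ‖η‖ ^ 2) * Real.cos (2 * Real.pi * (‖x‖ * τ)) := by
  obtain ⟨T, hTe, hT, hTp⟩ := exists_measurePreserving_radial x
  have h1 : Integrable (fun p : ℝ × EuclideanSpace ℝ (Fin n) => g √(p.1 ^ 2 + ‖p.2‖ ^ 2))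
      (volume.prod volume) := by
    have := (hT.integrable_comp_emb hTe).2 hgi
    refine this.congr (ae_of_all _ fun p => ?_)
    simp [(hTp p).1]
  refine ⟨h1, ?_⟩
  have h2 : Integrable (fun p : ℝ × EuclideanSpace ℝ (Fin n) => g √(p.1 ^ 2 + ‖p.2‖ ^ 2) *
      Real.cos (2 * Real.pi * (‖x‖ * p.1))) (volume.prod volume) :=
    h1.mul_bdd (c := 1) (Continuous.aestronglyMeasurable (by fun_prop))
      (ae_of_all _ fun p => Real.abs_cos_le_one _)
  rw [← hT.integral_comp hTe, Measure.volume_eq_prod, integral_prod]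
  · simp only [(hTp _).1, (hTp _).2]
  · simpa only [(hTp _).1, (hTp _).2] using h2

theorem exists_integral_radial_mul_cos_eq {k : ℕ}
    (hk : IntegrableOn (fun t => t ^ (2 * k) * g t) (Set.Ioi 0)) :
    ∃ c : ℝ, 0 < c ∧ ∀ x : EuclideanSpace ℝ (Fin (2 * k + 1)),
      ∫ ω, g ‖ω‖ * Real.cos (2 * Real.pi * inner ℝ x ω) = c * radialTransform g k ‖x‖ := by
  have hgi : Integrable fun ω : EuclideanSpace ℝ (Fin (2 * k + 1)) => g ‖ω‖ := by
    rw [integrable_fun_norm_addHaar]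
    simpa using hk
  cases k with
  | zero =>
    -- The transverse space is a point, and folding the even integrand onto the half line gives `2`.
    refine ⟨2, two_pos, fun x => ?_⟩
    have h := (integral_radial_mul_cos_eq_integral_integral (n := 2 * 0) hgi x).2
    refine h.trans ?_
    have : IsEmpty (Fin (2 * 0)) := Fin.isEmpty'
    have hvol : (volume : Measure (EuclideanSpace ℝ (Fin (2 * 0)))) = Measure.dirac 0 :=
      volume_euclideanSpace_eq_dirac _
    simp only [hvol, integral_dirac, norm_zero]
    have h2 : ∀ τ : ℝ, g √(τ ^ 2 + 0 ^ 2) * Real.cos (2 * Real.pi * (‖x‖ * τ)) =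
        (fun t => t ^ (2 * 0) * g t * walkKernel 0 (2 * Real.pi * t * ‖x‖)) |τ| := fun τ => by
      simp only [ne_eq, OfNat.ofNat_ne_zero, not_false_eq_true, zero_pow, add_zero,
        Real.sqrt_sq_eq_abs, mul_zero, pow_zero, one_mul, walkKernel]
      rw [← Real.cos_abs (2 * Real.pi * (‖x‖ * τ))]
      simp only [abs_mul, abs_norm, abs_of_pos Real.pi_pos, Nat.abs_ofNat]
      ring_nf
    simp only [h2]
    rw [integral_comp_abs (f := fun t => t ^ (2 * 0) * g t * walkKernel 0 (2 * Real.pi * t * ‖x‖))]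
    rfl
  | succ k =>
    have : Nonempty (Fin (2 * (k + 1))) := ⟨0, by omega⟩
    -- Dimension times volume of the unit ball: the area of the unit sphere of the transverse space,
    -- from spherical coordinates there.
    set c : ℝ := Module.finrank ℝ (EuclideanSpace ℝ (Fin (2 * (k + 1)))) *
      volume.real (Metric.ball (0 : EuclideanSpace ℝ (Fin (2 * (k + 1)))) 1) with hc
    have hdim : Module.finrank ℝ (EuclideanSpace ℝ (Fin (2 * (k + 1)))) - 1 = 2 * k + 1 := by
      rw [finrank_euclideanSpace_fin]
      omega
    have hc0 : 0 < c := by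
      refine mul_pos ?_ ?_
      · exact_mod_cast Module.finrank_pos
      · exact ENNReal.toReal_pos (Metric.measure_ball_pos _ _ one_pos).ne'
          measure_ball_lt_top.ne
    have hrad : ∀ f : ℝ → ℝ, ∫ η : EuclideanSpace ℝ (Fin (2 * (k + 1))), f ‖η‖ =
        c * ∫ ρ in Set.Ioi (0 : ℝ), ρ ^ (2 * k + 1) * f ρ := by
      intro f
      rw [integral_fun_norm_addHaar, hdim, hc]
      simp [mul_assoc]
    refine ⟨c, hc0, fun x => ?_⟩
    obtain ⟨hprod, h⟩ := integral_radial_mul_cos_eq_integral_integral (n := 2 * (k + 1)) hgi x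
    refine h.trans ?_
    have h1 : ∀ τ : ℝ, ∫ η : EuclideanSpace ℝ (Fin (2 * (k + 1))),
        g √(τ ^ 2 + ‖η‖ ^ 2) * Real.cos (2 * Real.pi * (‖x‖ * τ)) =
        c * ∫ ρ, (Set.Ioi (0 : ℝ)).indicator (fun ρ => ρ ^ (2 * k + 1) *
          (g √(τ ^ 2 + ρ ^ 2) * Real.cos (2 * Real.pi * (‖x‖ * τ)))) ρ := fun τ => by
      rw [hrad fun ρ => g √(τ ^ 2 + ρ ^ 2) * Real.cos (2 * Real.pi * (‖x‖ * τ)),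
        integral_indicator measurableSet_Ioi]
    simp only [h1]
    rw [integral_const_mul, ← integral_half_plane_eq_radialTransform hg hk ‖x‖,
      Measure.volume_eq_prod, integral_prod]
    have hmeas : ∀ f : ℝ × ℝ → ℝ, Continuous f → AEStronglyMeasurable
        (fun p : ℝ × ℝ => (Set.Ioi (0 : ℝ)).indicator (fun ρ => f (p.1, ρ)) p.2)
        (volume.prod volume) := by
      intro f hf
      have : (fun p : ℝ × ℝ => (Set.Ioi (0 : ℝ)).indicator (fun ρ => f (p.1, ρ)) p.2) =
          (Prod.snd ⁻¹' Set.Ioi (0 : ℝ)).indicator f := by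
        ext p
        simp [Set.indicator]
      rw [this]
      exact (hf.measurable.indicator (measurable_snd measurableSet_Ioi)).aestronglyMeasurable
    have hH : Integrable (fun p : ℝ × ℝ => (Set.Ioi (0 : ℝ)).indicator (fun ρ => ρ ^ (2 * k + 1) *
        g √(p.1 ^ 2 + ρ ^ 2)) p.2) (volume.prod volume) := by
      refine (integrable_prod_iff (hmeas (fun p => p.2 ^ (2 * k + 1) * g √(p.1 ^ 2 + p.2 ^ 2))
        (by fun_prop))).2 ⟨?_, ?_⟩
      · filter_upwards [hprod.prod_right_ae] with τ hτ
        rw [integrable_indicator_iff measurableSet_Ioi]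
        have := (integrable_fun_norm_addHaar
          (volume : Measure (EuclideanSpace ℝ (Fin (2 * (k + 1)))))
          (f := fun ρ => g √(τ ^ 2 + ρ ^ 2))).1 hτ
        rwa [hdim] at this
      · have h2 := hprod.integral_norm_prod_left
        have h3 : ∀ τ : ℝ, ∫ η : EuclideanSpace ℝ (Fin (2 * (k + 1))), ‖g √(τ ^ 2 + ‖η‖ ^ 2)‖ =
            c * ∫ ρ, ‖(Set.Ioi (0 : ℝ)).indicator (fun ρ => ρ ^ (2 * k + 1) *
              g √(τ ^ 2 + ρ ^ 2)) ρ‖ := fun τ => by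
          rw [hrad fun ρ => ‖g √(τ ^ 2 + ρ ^ 2)‖]
          simp only [norm_indicator_eq_indicator_norm]
          rw [integral_indicator measurableSet_Ioi]
          congr 1
          refine setIntegral_congr_fun measurableSet_Ioi fun ρ hρ => ?_
          have : (0 : ℝ) < ρ := hρ
          simp only [norm_mul, norm_pow, Real.norm_of_nonneg this.le]
        have h4 := (h2.congr (ae_of_all _ h3)).const_mul c⁻¹
        refine h4.congr (ae_of_all _ fun τ => ?_)
        simp only
        rw [inv_mul_cancel_left₀ hc0.ne']
    refine (hH.mul_bdd (c := 1) (g := fun p : ℝ × ℝ => Real.cos (2 * Real.pi * (‖x‖ * p.1)))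
      (Continuous.aestronglyMeasurable (by fun_prop))
      (ae_of_all _ fun p => Real.abs_cos_le_one _)).congr (ae_of_all _ fun p => ?_)
    simp only [Set.indicator]
    split_ifs
    · ring
    · simp

end RadialFourier

/-! ### The spectral density of the Wu kernel. -/

section WuKernel

theorem fourierInv_ofReal_of_even {V : Type*} [NormedAddCommGroup V] [InnerProductSpace ℝ V]
    [FiniteDimensional ℝ V] [MeasurableSpace V] [BorelSpace V] {m : V → ℝ} (hm : Integrable m)
    (heven : ∀ ω, m (-ω) = m ω) (x : V) :
    𝓕⁻ (fun ω => (m ω : ℂ)) x = ((∫ ω, m ω * Real.cos (2 * Real.pi * inner ℝ x ω) : ℝ) : ℂ) := by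
  have hcos : Integrable fun ω => m ω * Real.cos (2 * Real.pi * inner ℝ x ω) :=
    hm.mul_bdd (c := 1) (Continuous.aestronglyMeasurable (by fun_prop))
      (ae_of_all _ fun ω => Real.abs_cos_le_one _)
  have hsin : Integrable fun ω => m ω * Real.sin (2 * Real.pi * inner ℝ x ω) :=
    hm.mul_bdd (c := 1) (Continuous.aestronglyMeasurable (by fun_prop))
      (ae_of_all _ fun ω => Real.abs_sin_le_one _)
  have hsin0 : ∫ ω, m ω * Real.sin (2 * Real.pi * inner ℝ x ω) = 0 := by
    have h := integral_neg_eq_self (fun ω => m ω * Real.sin (2 * Real.pi * inner ℝ x ω)) volume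
    simp only [heven, inner_neg_right, mul_neg, Real.sin_neg, integral_neg] at h
    linarith
  have hpt : ∀ ω, star (planeWave x ω) * (m ω : ℂ) =
      ((m ω * Real.cos (2 * Real.pi * inner ℝ x ω) : ℝ) : ℂ) +
        ((m ω * Real.sin (2 * Real.pi * inner ℝ x ω) : ℝ) : ℂ) * Complex.I := fun ω => by
    rw [star_planeWave, planeWave, inner_neg_right, mul_neg, neg_neg, Complex.exp_mul_I]
    push_cast
    ring
  rw [fourierInv_eq_integral_planeWave]
  simp only [hpt]
  rw [integral_add hcos.ofReal (hsin.ofReal.mul_const _), integral_mul_const,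
    integral_complex_ofReal, integral_complex_ofReal, hsin0]
  simp

theorem exists_wuFun_eq {ℓ : ℝ} {k : ℕ} (hkℓ : (k : ℝ) ≤ ℓ) :
    ∃ c : ℝ, 0 < c ∧ wuFun ℓ k = fun r =>
      c * radialTransform (fun t => truncPowHat ℓ t ^ 2) k r := by
  have hℓ : 0 ≤ ℓ := (Nat.cast_nonneg k).trans hkℓ
  have hg : Continuous fun t => truncPowHat ℓ t ^ 2 := (continuous_truncPowHat hℓ).pow 2
  have hconv : convolution (truncPow ℓ) (truncPow ℓ) (ContinuousLinearMap.mul ℝ ℝ) volume =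
      fun r => 2 * radialTransform (fun t => truncPowHat ℓ t ^ 2) 0 r := by
    ext r
    rw [convolution_truncPow_eq hℓ]
    have h : ∀ t : ℝ, truncPowHat ℓ t ^ 2 * Real.cos (2 * Real.pi * t * r) =
        (fun t => t ^ (2 * 0) * truncPowHat ℓ t ^ 2 * walkKernel 0 (2 * Real.pi * t * r)) |t| := by
      intro t
      rcases abs_choice t with h | h <;> rw [h] <;>
        simp [walkKernel, truncPowHat_neg]
    simp only [h]
    rw [integral_comp_abs (f := fun t => t ^ (2 * 0) * truncPowHat ℓ t ^ 2 *
      walkKernel 0 (2 * Real.pi * t * r))]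
    rfl
  rw [wuFun, hconv]
  refine exists_dimWalk_iterate_eq hg (fun j hj => ?_) two_pos
  refine (integrable_pow_mul_truncPowHat_sq hℓ ?_).integrableOn
  have : (j : ℝ) ≤ k := by exact_mod_cast hj
  push_cast
  linarith

theorem exists_isSpectralDensity_wuKernel {ℓ : ℝ} {k : ℕ} (hkℓ : (k : ℝ) ≤ ℓ) :
    ∃ (m : EuclideanSpace ℝ (Fin (2 * k + 1)) → ℝ) (C : ℝ),
      IsSpectralDensity (wuKernel ℓ k) m ∧
      ∀ ω, m ω ≤ C * (1 + ‖(2 * Real.pi) • ω‖ ^ 2) ^ (-(ℓ + 1)) := by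
  have hℓ : 0 ≤ ℓ := (Nat.cast_nonneg k).trans hkℓ
  have hg : Continuous fun t => truncPowHat ℓ t ^ 2 := (continuous_truncPowHat hℓ).pow 2
  have hk : IntegrableOn (fun t => t ^ (2 * k) * truncPowHat ℓ t ^ 2) (Set.Ioi 0) :=
    (integrable_pow_mul_truncPowHat_sq hℓ (by push_cast; linarith)).integrableOn
  obtain ⟨c₁, hc₁, hwu⟩ := exists_wuFun_eq hkℓ
  obtain ⟨c₂, hc₂, hrad⟩ := exists_integral_radial_mul_cos_eq hg hk
  obtain ⟨C, hC⟩ := exists_truncPowHat_sq_le hℓ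
  have hint : Integrable fun ω : EuclideanSpace ℝ (Fin (2 * k + 1)) =>
      c₁ / c₂ * truncPowHat ℓ ‖ω‖ ^ 2 := by
    refine Integrable.const_mul ?_ _
    refine (integrable_fun_norm_addHaar volume (f := fun t => truncPowHat ℓ t ^ 2)).2 ?_
    simpa using hk
  -- Here `c₁` comes from iterating `𝒟` and `c₂` from the radial Fourier integral; their quotient
  -- makes the inverse transform exactly `Φ`.
  refine ⟨fun ω => c₁ / c₂ * truncPowHat ℓ ‖ω‖ ^ 2, c₁ / c₂ * C, ⟨?_, fun ω => by positivity,
    fun ω => by rw [norm_neg], hint, ?_, fun x y => ?_⟩, fun ω => ?_⟩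
  · have := continuous_truncPowHat hℓ
    fun_prop
  -- The density vanishes only on spheres whose radii lie in a countable set.
  · have hnull : volume (⋃ t ∈ {t | truncPowHat ℓ t = 0},
        Metric.sphere (0 : EuclideanSpace ℝ (Fin (2 * k + 1))) t) = 0 :=
      (measure_biUnion_null_iff (countable_truncPowHat_eq_zero hℓ)).2 fun t _ =>
        Measure.addHaar_sphere _ _ _
    refine measure_mono_null (fun ω hω => ?_) hnull
    have h0 : truncPowHat ℓ ‖ω‖ = 0 := by
      have : ¬ (c₁ / c₂ * truncPowHat ℓ ‖ω‖ ^ 2 ≠ 0) := hω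
      rw [not_not] at this
      have h2 := (mul_eq_zero.1 this).resolve_left (by positivity)
      exact pow_eq_zero_iff two_ne_zero |>.1 h2
    exact Set.mem_biUnion (x := ‖ω‖) h0 (by simp)
  · rw [fourierInv_ofReal_of_even hint fun ω => by rw [norm_neg]]
    simp only [mul_assoc (c₁ / c₂)]
    rw [integral_const_mul]
    have h := hrad (x - y)
    rw [h, wuKernel, hwu]
    congr 1
    field_simp
  · have h := hC ‖ω‖
    rw [norm_smul, Real.norm_of_nonneg (by positivity), mul_assoc (c₁ / c₂)]
    exact mul_le_mul_of_nonneg_left h (by positivity)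

end WuKernel

theorem theorem3p9 (k : ℕ) (ℓ : ℝ) (hkℓ : (k : ℝ) ≤ ℓ) :
    (∃ (H : Type) (_ : NormedAddCommGroup H) (_ : InnerProductSpace ℝ H) (_ : CompleteSpace H)
        (_ : RKHS ℝ H (EuclideanSpace ℝ (Fin (2 * k + 1))) ℝ),
      IsNativeSpace (wuKernel ℓ k) H) ∧
    ∀ (H : Type*) [NormedAddCommGroup H] [InnerProductSpace ℝ H] [CompleteSpace H]
        [RKHS ℝ H (EuclideanSpace ℝ (Fin (2 * k + 1))) ℝ],
      IsNativeSpace (wuKernel ℓ k) H →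
      ∀ s : ℝ, (k : ℝ) + 1 / 2 < s → s ≤ ℓ + 1 →
        IsDenseInSobolev s
          (Set.range fun (h : H) (x : EuclideanSpace ℝ (Fin (2 * k + 1))) => h x) := by
  have hℓ : 0 ≤ ℓ := (Nat.cast_nonneg k).trans hkℓ
  obtain ⟨m, C, hm, hC⟩ := exists_isSpectralDensity_wuKernel hkℓ
  exact ⟨hm.isPosDefKernel.exists_isNativeSpace, fun H _ _ _ _ hH s _ hs =>
    hm.isDenseInSobolev hC hH (by linarith) hs⟩
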